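/- Let $W_n$ be the group of signed permutations of $\{1,\dots,n\}$ (bijections $w$ of $\{\pm1,\dots,\pm n\}$ with $w(-i)=-w(i)$), and let $W_\infty=\bigcup_n W_n$, where $W_n\subset W_{n+1}$ by adjoining the fixed point $n+1$. It is generated by the sign change $s_0\colon 1\mapsto -1$ and the transpositions $s_i=(i,i+1)$, $i\ge 1$. The length $\ell(w)$ is the least length of a word in the $s_i$ with product $w$. The nilCoxeter algebra of $W_n$ is the free associative algebra with unity generated by $u_0,\dots,u_{n-1}$ modulo the relations $u_i^2=0$; $u_iu_j=u_ju_i$ for $|i-j|\ge 2$; $u_iu_{i+1}u_i=u_{i+1}u_iu_{i+1}$ for $i>0$; $u_0u_1u_0u_1=u_1u_0u_1u_0$. It is free on the elements $u_w=u_{a_1}\cdots u_{a_\ell}$, $w\in W_n$, where $a_1\cdots a_\ell$ is any reduced word of $w$; after extending scalars, let $\langle h,w\rangle$ denote the coefficient of $u_w$ in $h$. Let $X=(x_1,x_2,\dots)$, $Y=(y_1,y_2,\dots)$, $Z=(z_1,z_2,\dots)$ be commuting variables and put $$A_i(t)=(1+tu_{n-1})\cdots(1+tu_i),\qquad \tilde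 A_i(t)=(1-tu_i)\cdots(1-tu_{n-1}),$$ $$C(t)=(1+tu_{n-1})\cdots(1+tu_1)(1+tu_0)(1+tu_0)(1+tu_1)\cdots(1+tu_{n-1}),\qquad C(X)=C(x_1)C(x_2)\cdots .$$ The type C double Schubert polynomial of $w\in W_n$ is the formal power series $$\mathfrak C_w(X;Y,Z)=\big\langle \tilde A_{n-1}(z_{n-1})\cdots\tilde A_1(z_1)\,C(X)\,A_1(y_1)\cdots A_{n-1}(y_{n-1}),\,w\big\rangle .$$ Define $q_r(X)$ by $\prod_{i\ge1}\frac{1+x_it}{1-x_it}=\sum_{r\ge0}q_r(X)t^r$, let $\Gamma=\mathbb Z[q_1(X),q_2(X),\dots]$, and let $\Gamma[Y,Z]$ be the polynomial ring in $Y$, $Z$ over $\Gamma$, regarded as a subring of the ring of formal power series over $\mathbb Z$ in $X,Y,Z$. Let $s_i$, $i\ge1$, act on $\Gamma[Y,Z]$ by interchanging $y_i$ and $y_{i+1}$ and fixing all $q_r(X)$, all $z_j$ and the other $y_j$; let $s_0$ be the ring automorphism which maps $y_1$ to $-y_1$, fixes $y_j$ ($j\ge2$) and all $z_j$, and maps $$q_r(X)\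 \text{ to }\ q_r(y_1,x_1,x_2,\dots)=q_r(X)+2\sum_{j=1}^r y_1^jq_{r-j}(X).$$ Put $\partial_0^yf=\frac{f-s_0f}{-2y_1}$ and $\partial_i^yf=\frac{f-s_if}{y_i-y_{i+1}}$ for $i\ge1$; let $\omega$ be the ring involution of $\Gamma[Y,Z]$ with $\omega(y_j)=-z_j$, $\omega(z_j)=-y_j$, $\omega(q_r(X))=q_r(X)$, and put $\partial_i^z=\omega\,\partial_i^y\,\omega$. **Theorem.** The series $\mathfrak C_w$ does not depend on the choice of $n$ with $w\in W_n$, and $\mathfrak C_w\in\Gamma[Y,Z]$ for all $w\in W_\infty$. For all $i\ge0$ and $w\in W_\infty$, $$\partial_i^y\mathfrak C_w=\begin{cases}\mathfrak C_{ws_i}&\text{if }\ell(ws_i)<\ell(w),\\0&\text{otherwise,}\end{cases}\qquad \partial_i^z\mathfrak C_w=\begin{cases}\mathfrak C_{s_iw}&\text{if }\ell(s_iw)<\ell(w),\\0&\text{otherwise,}\end{cases}$$ and the constant term of $\mathfrak C_w$ is $1$ if $w=1$ and $0$ otherwise. Moreover $(\mathfrak C_w)_{w\in W_\infty}$ is the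 only family of elements of $\Gamma[Y,Z]$, indexed by $W_\infty$, which satisfies all these equations and this condition on the constant terms. -/

import Mathlib

noncomputable section
namespace TypeC

/-- The group `W_∞` of signed permutations: permutations `w` of `ℤ` with `w (-i) = - w i` that
move only finitely many integers. -/
def SignedPerm : Subgroup (Equiv.Perm ℤ) where
  carrier := {w | (∀ i, w (-i) = -w i) ∧ {i | w i ≠ i}.Finite}
  one_mem' := by simp
  mul_mem' := by
    rintro v w ⟨hv, hv'⟩ ⟨hw, hw'⟩
    refine ⟨fun i => by simp [hv, hw], (hv'.union hw').subset fun i hi => ?_⟩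
    by_contra h
    simp only [Set.mem_union, Set.mem_ofPred_eq, not_or, not_not] at h
    exact hi (by simp [h.1, h.2])
  inv_mem' := by
    rintro w ⟨hw, hw'⟩
    refine ⟨fun i => ?_, hw'.subset fun i hi => ?_⟩
    · rw [Equiv.Perm.inv_eq_iff_eq, hw]; simp
    · intro h
      exact hi (by rw [Equiv.Perm.inv_eq_iff_eq]; exact h.symm)

/-- `W_n`, the signed permutations of `{1, …, n}`, as a subset of `W_∞`. -/
def finiteW (n : ℕ) : Set SignedPerm :=
  {w | ∀ i : ℤ, (n : ℤ) < |i| → (w : Equiv.Perm ℤ) i = i}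

/-- The simple reflections, as permutations of `ℤ`. -/
def sPerm : ℕ → Equiv.Perm ℤ
  | 0 => Equiv.swap 1 (-1)
  | k + 1 => Equiv.swap ((k : ℤ) + 1) (k + 2) * Equiv.swap (-((k : ℤ) + 1)) (-(k + 2))

theorem sPerm_zero_apply (x : ℤ) :
    sPerm 0 x = if x = 1 then -1 else if x = -1 then 1 else x := by
  simp [sPerm, Equiv.swap_apply_def]

theorem sPerm_succ_apply (k : ℕ) (x : ℤ) :
    sPerm (k + 1) x = if x = k + 1 then (k : ℤ) + 2 else if x = k + 2 then (k : ℤ) + 1 else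
      if x = -((k : ℤ) + 1) then -((k : ℤ) + 2) else
      if x = -((k : ℤ) + 2) then -((k : ℤ) + 1) else x := by
  simp only [sPerm, Equiv.Perm.mul_apply, Equiv.swap_apply_def]
  split_ifs <;> omega

theorem sPerm_mem (i : ℕ) : sPerm i ∈ SignedPerm := by
  constructor
  · intro x
    cases i with
    | zero => simp only [sPerm_zero_apply]; split_ifs <;> omega
    | succ k => simp only [sPerm_succ_apply]; split_ifs <;> omega
  · cases i with
    | zero =>
      refine (Set.toFinite {1, -1}).subset fun x hx => ?_
      simp only [Set.mem_ofPred_eq, sPerm_zero_apply] at hx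
      simp only [Set.mem_insert_iff, Set.mem_singleton_iff]
      grind
    | succ k =>
      refine (Set.toFinite {(k : ℤ) + 1, (k : ℤ) + 2, -((k : ℤ) + 1), -((k : ℤ) + 2)}).subset
        fun x hx => ?_
      simp only [Set.mem_ofPred_eq, sPerm_succ_apply] at hx
      simp only [Set.mem_insert_iff, Set.mem_singleton_iff]
      grind

/-- The simple reflections: `s 0` is the sign change `1 ↦ -1`, and `s i`, for `i ≥ 1`, is the
transposition of `i` and `i + 1` (and of `-i` and `-(i + 1)`). -/
def s (i : ℕ) : SignedPerm := ⟨sPerm i, sPerm_mem i⟩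

theorem s_mul_self (i : ℕ) : s i * s i = 1 := by
  ext x
  simp only [s, Subgroup.coe_mul, Subgroup.coe_one, Equiv.Perm.mul_apply, Equiv.Perm.one_apply]
  cases i with
  | zero => grind [sPerm_zero_apply]
  | succ k => grind (splits := 40) [sPerm_succ_apply]

theorem s_comm {i j : ℕ} (h : i + 2 ≤ j) : s i * s j = s j * s i := by
  ext x
  obtain ⟨j, rfl⟩ : ∃ k, j = k + 1 := ⟨j - 1, by omega⟩
  simp only [s, Subgroup.coe_mul, Equiv.Perm.mul_apply]
  cases i with
  | zero => grind (splits := 40) [sPerm_zero_apply, sPerm_succ_apply]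
  | succ k => grind (splits := 40) [sPerm_succ_apply]

theorem s_braid (i : ℕ) (h : 0 < i) : s i * s (i + 1) * s i = s (i + 1) * s i * s (i + 1) := by
  ext x
  obtain ⟨i, rfl⟩ : ∃ k, i = k + 1 := ⟨i - 1, by omega⟩
  simp only [s, Subgroup.coe_mul, Equiv.Perm.mul_apply]
  grind (splits := 40) [sPerm_succ_apply]

theorem s_four : s 0 * s 1 * s 0 * s 1 = s 1 * s 0 * s 1 * s 0 := by
  ext x
  simp only [s, Subgroup.coe_mul, Equiv.Perm.mul_apply]
  grind (splits := 40) [sPerm_zero_apply, sPerm_succ_apply]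

/-- The length of a signed permutation: the least length of a word in the simple reflections with
product `w`. -/
def length (w : SignedPerm) : ℕ := sInf {k | ∃ a : List ℕ, a.length = k ∧ (a.map s).prod = w}

/-- `a` is a reduced word of `w`. -/
def IsReducedWord (a : List ℕ) (w : SignedPerm) : Prop :=
  (a.map s).prod = w ∧ a.length = length w

theorem length_le {a : List ℕ} {w : SignedPerm} (h : (a.map s).prod = w) :
    length w ≤ a.length := Nat.sInf_le ⟨a, rfl, h⟩


/-- The defining relations of the nilCoxeter algebra of `W_n`, on the free associative algebra with
generators `u_0, …, u_{n-1}`. -/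
inductive NilCoxeterRel (R : Type) [CommRing R] (n : ℕ) :
    FreeAlgebra R (Fin n) → FreeAlgebra R (Fin n) → Prop
  | sq (i : Fin n) : NilCoxeterRel R n (FreeAlgebra.ι R i * FreeAlgebra.ι R i) 0
  | comm (i j : Fin n) (h : (i : ℕ) + 2 ≤ j) :
      NilCoxeterRel R n (FreeAlgebra.ι R i * FreeAlgebra.ι R j)
        (FreeAlgebra.ι R j * FreeAlgebra.ι R i)
  | braid (i j : Fin n) (hi : 0 < (i : ℕ)) (h : (j : ℕ) = i + 1) :
      NilCoxeterRel R n (FreeAlgebra.ι R i * FreeAlgebra.ι R j * FreeAlgebra.ι R i)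
        (FreeAlgebra.ι R j * FreeAlgebra.ι R i * FreeAlgebra.ι R j)
  | four (i j : Fin n) (hi : (i : ℕ) = 0) (hj : (j : ℕ) = 1) :
      NilCoxeterRel R n
        (FreeAlgebra.ι R i * FreeAlgebra.ι R j * FreeAlgebra.ι R i * FreeAlgebra.ι R j)
        (FreeAlgebra.ι R j * FreeAlgebra.ι R i * FreeAlgebra.ι R j * FreeAlgebra.ι R i)

/-- The nilCoxeter algebra of `W_n` with coefficients in `R`: the free associative algebra on
`u_0, …, u_{n-1}` modulo the nilCoxeter relations. -/
abbrev NilCoxeter (R : Type) [CommRing R] (n : ℕ) : Type :=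
  (ringConGen (NilCoxeterRel R n)).Quotient

/-- The generator `u_i` of the nilCoxeter algebra. -/
def u (R : Type) [CommRing R] {n : ℕ} (i : Fin n) : NilCoxeter R n :=
  ((FreeAlgebra.ι R i : FreeAlgebra R (Fin n)) : (ringConGen (NilCoxeterRel R n)).Quotient)

section coefficient

variable {R : Type} [CommRing R] {n : ℕ}

theorem basisFreeMonoid_eq (a : FreeMonoid (Fin n)) :
    FreeAlgebra.basisFreeMonoid R (Fin n) a = FreeMonoid.lift (FreeAlgebra.ι R) a := by
  simp only [FreeAlgebra.basisFreeMonoid, Module.Basis.map_apply, Finsupp.coe_basisSingleOne]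
  change FreeAlgebra.equivMonoidAlgebraFreeMonoid.symm (MonoidAlgebra.single a 1) = _
  simp [FreeAlgebra.equivMonoidAlgebraFreeMonoid]

open Classical in
/-- The linear functional on the free algebra whose value on a word is `1` if the word is a reduced
word of `w`, and `0` otherwise. -/
def freeCoeff (w : SignedPerm) : FreeAlgebra R (Fin n) →ₗ[R] R :=
  (FreeAlgebra.basisFreeMonoid R (Fin n)).constr R fun a : FreeMonoid (Fin n) =>
    if IsReducedWord (a.toList.map Fin.val) w then 1 else 0

open Classical in
theorem freeCoeff_word (w : SignedPerm) (a : FreeMonoid (Fin n)) :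
    freeCoeff w (FreeMonoid.lift (FreeAlgebra.ι R) a) =
      if IsReducedWord (a.toList.map Fin.val) w then 1 else 0 := by
  rw [← basisFreeMonoid_eq, freeCoeff, Module.Basis.constr_basis]

theorem freeCoeff_ext {w : SignedPerm} {x y : FreeAlgebra R (Fin n)}
    (h : ∀ p q : FreeMonoid (Fin n),
      freeCoeff w (FreeMonoid.lift (FreeAlgebra.ι R) p * x * FreeMonoid.lift (FreeAlgebra.ι R) q) =
      freeCoeff w (FreeMonoid.lift (FreeAlgebra.ι R) p * y * FreeMonoid.lift (FreeAlgebra.ι R) q))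
    (p q : FreeAlgebra R (Fin n)) : freeCoeff w (p * x * q) = freeCoeff w (p * y * q) := by
  let b := FreeAlgebra.basisFreeMonoid R (Fin n)
  let F (z : FreeAlgebra R (Fin n)) :
      FreeAlgebra R (Fin n) →ₗ[R] FreeAlgebra R (Fin n) →ₗ[R] R :=
    LinearMap.compr₂ ((LinearMap.mul R _).comp (LinearMap.mulRight R z)) (freeCoeff w)
  have hF : F x = F y := b.ext fun p => b.ext fun q => by
    simpa [F, b, basisFreeMonoid_eq] using h p q
  simpa [F] using congrArg (fun G => G p q) hF

/-- The congruence on the free algebra of having, in every context, the same coefficients. -/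
def coeffCon (R : Type) [CommRing R] (n : ℕ) : RingCon (FreeAlgebra R (Fin n)) where
  r x y := ∀ (w : SignedPerm) (p q : FreeAlgebra R (Fin n)),
    freeCoeff w (p * x * q) = freeCoeff w (p * y * q)
  iseqv := ⟨fun _ _ _ _ => rfl, fun h w p q => (h w p q).symm,
    fun h h' w p q => (h w p q).trans (h' w p q)⟩
  mul' := fun {x y x' y'} h h' w p q => by
    have e₁ := h w p (x' * q)
    have e₂ := h' w (p * y) q
    simp only [mul_assoc] at e₁ e₂ ⊢
    exact e₁.trans e₂
  add' := fun {x y x' y'} h h' w p q => by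
    simp only [mul_add, add_mul, map_add, h w p q, h' w p q]

theorem isReducedWord_congr {a b : List ℕ} (h : (a.map s).prod = (b.map s).prod)
    (hl : a.length = b.length) (w : SignedPerm) : IsReducedWord a w ↔ IsReducedWord b w := by
  simp only [IsReducedWord, h, hl]

theorem not_isReducedWord_sq (p q : List ℕ) (i : ℕ) (w : SignedPerm) :
    ¬ IsReducedWord (p ++ [i, i] ++ q) w := by
  rintro ⟨h, hl⟩
  have : ((p ++ q).map s).prod = w := by
    rw [← h]; simp only [List.map_append, List.prod_append, List.map_cons, List.map_nil,
      List.prod_cons, List.prod_nil, mul_one, s_mul_self]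
  have := length_le this
  simp at hl this
  omega

theorem freeCoeff_words {a b : FreeMonoid (Fin n)}
    (h : ((a.toList.map Fin.val).map s).prod = ((b.toList.map Fin.val).map s).prod)
    (hl : a.toList.length = b.toList.length) (w : SignedPerm) (p q : FreeAlgebra R (Fin n)) :
    freeCoeff w (p * FreeMonoid.lift (FreeAlgebra.ι R) a * q) =
      freeCoeff w (p * FreeMonoid.lift (FreeAlgebra.ι R) b * q) := by
  refine freeCoeff_ext (fun p q => ?_) p q
  simp only [← map_mul, freeCoeff_word]
  congr 1
  refine propext (isReducedWord_congr ?_ ?_ w)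
  · simp only [FreeMonoid.toList_mul, List.map_append, List.prod_append, h]
  · simp [hl]

theorem ringConGen_le_coeffCon : ringConGen (NilCoxeterRel R n) ≤ coeffCon R n := by
  rw [RingCon.ringConGen_le]
  intro x y h
  change ∀ (w : SignedPerm) (p q : FreeAlgebra R (Fin n)), _
  intro w
  have hι (i : Fin n) : FreeAlgebra.ι R i = FreeMonoid.lift (FreeAlgebra.ι R) (.of i) := by simp
  cases h with
  | sq i =>
    refine freeCoeff_ext fun p q => ?_
    rw [hι, ← map_mul, ← map_mul, ← map_mul, freeCoeff_word, if_neg]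
    · simp
    · simpa using not_isReducedWord_sq (p.toList.map Fin.val) (q.toList.map Fin.val) i w
  | comm i j h =>
    rw [hι i, hι j, ← map_mul, ← map_mul]
    exact freeCoeff_words (by simpa using s_comm h) (by simp) w
  | braid i j hi h =>
    rw [hι i, hι j, ← map_mul, ← map_mul, ← map_mul, ← map_mul]
    exact freeCoeff_words (by simpa [h, mul_assoc] using s_braid i hi) (by simp) w
  | four i j hi hj =>
    rw [hι i, hι j, ← map_mul, ← map_mul, ← map_mul, ← map_mul, ← map_mul, ← map_mul]
    exact freeCoeff_words (by simpa [hi, hj, mul_assoc] using s_four) (by simp) w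

/-- The coefficient `⟨h, w⟩` of `u_w` in an element `h` of the nilCoxeter algebra. It is the linear
functional in `h` which sends `u_{a_1} ⋯ u_{a_k}` to `1` if `a_1 ⋯ a_k` is a reduced word of `w`
(so that this product is `u_w`), and to `0` otherwise (when the product is `0` or some `u_v` with
`v ≠ w`). -/
def coeff (w : SignedPerm) : NilCoxeter R n →ₗ[R] R where
  toFun := Quotient.lift (freeCoeff w) fun x y h => by
    simpa using ringConGen_le_coeffCon h w 1 1
  map_add' := by
    rintro ⟨x⟩ ⟨y⟩
    exact map_add (freeCoeff w) x y
  map_smul' := by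
    rintro r ⟨x⟩
    exact map_smul (freeCoeff w) r x

open Classical in
theorem coeff_word (w : SignedPerm) (a : List (Fin n)) :
    coeff w (a.map (u R)).prod = if IsReducedWord (a.map Fin.val) w then 1 else 0 := by
  have : (a.map (u R)).prod = ((FreeMonoid.lift (FreeAlgebra.ι R) (.ofList a) :
      FreeAlgebra R (Fin n)) : (ringConGen (NilCoxeterRel R n)).Quotient) := by
    induction a with
    | nil => simp
    | cons i a ih => rw [FreeMonoid.ofList_cons, map_mul, RingCon.coe_mul, ← ih]; simp [u]
  rw [this]
  exact freeCoeff_word w _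

end coefficient

/-- The variables: `x i`, `y i`, `z i` stand for `x_{i+1}`, `y_{i+1}`, `z_{i+1}`. -/
inductive Var : Type
  | x (i : ℕ)
  | y (i : ℕ)
  | z (i : ℕ)

/-- Polynomials over `ℤ` in the three sequences of variables. -/
abbrev Poly : Type := MvPolynomial Var ℤ

/-- Formal power series over `ℤ` in the three sequences of variables. -/
abbrev Series : Type := MvPowerSeries Var ℤ

/-- `N` for the variable `x_N`, and `0` for the variables `y_j` and `z_j`. -/
def xIndex : Var → ℕ
  | .x i => i + 1
  | .y _ => 0
  | .z _ => 0

/-- The least `N` such that a monomial involves, of the variables `X`, only `x_1, …, x_N`. -/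
def xBound (m : Var →₀ ℕ) : ℕ := m.support.sup xIndex

/-- The limit, for `N → ∞`, of a sequence of polynomials `p N` in `x_1, …, x_N` and the variables
`Y`, `Z` such that `p N` is obtained from `p (N + 1)` by setting `x_{N+1} = 0`: the coefficient of a
monomial in the limit is its coefficient in `p N` for any `N` such that the monomial involves none
of the variables `x_{N+1}, x_{N+2}, …`. -/
def xLimit (p : ℕ → Poly) : Series := fun m => MvPolynomial.coeff m (p (xBound m))

/-- The power series `(1 + a t) / (1 - a t) = (1 + a t) ∑_k a ^ k t ^ k` in `t`. -/
def qFactor (a : Poly) : PowerSeries Poly :=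
  (1 + PowerSeries.C a * PowerSeries.X) * PowerSeries.mk fun k => a ^ k

/-- The polynomial `q_r (x_1, …, x_N)`: the coefficient of `t ^ r` in
`∏_{i ≤ N} (1 + x_i t) / (1 - x_i t)`. -/
def qPoly (r N : ℕ) : Poly :=
  PowerSeries.coeff r (∏ i ∈ Finset.range N, qFactor (MvPolynomial.X (Var.x i)))

/-- The formal power series `q_r(X)`. -/
def q (r : ℕ) : Series := xLimit (qPoly r)

/-- The ring `Γ[Y,Z]`, where `Γ = ℤ[q_1, q_2, …]`, as a subring of the ring of formal power series
in `X`, `Y`, `Z`. -/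
def GammaYZ : Subalgebra ℤ Series :=
  Algebra.adjoin ℤ (Set.range q ∪ Set.range (fun j => MvPowerSeries.X (Var.y j)) ∪
    Set.range (fun j => MvPowerSeries.X (Var.z j)))

/-- The values of the variables under `s_i`: for `i ≥ 1`, `s_i` interchanges `y_i` and `y_{i+1}`;
`s_0` maps `y_1` to `-y_1` and `f(x_1, x_2, …)` to `f(y_1, x_1, x_2, …)`. -/
def reflVar : ℕ → Var → Poly
  | 0, .x 0 => MvPolynomial.X (.y 0)
  | 0, .x (k + 1) => MvPolynomial.X (.x k)
  | 0, .y 0 => -MvPolynomial.X (.y 0)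
  | i + 1, .y j => MvPolynomial.X (.y (Equiv.swap i (i + 1) j))
  | _, v => MvPolynomial.X v

/-- The values of the variables under the involution `ω`. -/
def omegaVar : Var → Poly
  | .x i => MvPolynomial.X (.x i)
  | .y j => -MvPolynomial.X (.z j)
  | .z j => -MvPolynomial.X (.y j)

/-- The sequence number of a variable. -/
def idx : Var → ℕ
  | .x i => i
  | .y i => i
  | .z i => i

/-- Substitutions which map each variable to a variable, up to sign, and lower indices by at most
one. -/
def IsTame (a : Var → Poly) : Prop :=
  ∃ (σ : Var → Var) (ε : Var → ℤ), ∀ v, a v = MvPolynomial.C (ε v) * MvPolynomial.X (σ v) ∧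
    idx v ≤ idx (σ v) + 1 ∧ xIndex v ≤ xIndex (σ v) + 1

theorem isTame_reflVar (i : ℕ) : IsTame (reflVar i) := by
  cases i with
  | zero =>
    refine ⟨fun | .x 0 => .y 0 | .x (k + 1) => .x k | v => v, fun | .y 0 => -1 | _ => 1, ?_⟩
    rintro ((_ | k) | (_ | k) | k) <;> simp [reflVar, idx, xIndex]
  | succ i =>
    refine ⟨fun | .y j => .y (Equiv.swap i (i + 1) j) | v => v, fun _ => 1, ?_⟩
    rintro (k | k | k) <;> simp [reflVar, idx, xIndex]
    rw [Equiv.swap_apply_def]; split_ifs <;> omega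

theorem isTame_omegaVar : IsTame omegaVar := by
  refine ⟨fun | .x i => .x i | .y i => .z i | .z i => .y i, fun | .x _ => 1 | _ => -1, ?_⟩
  rintro (k | k | k) <;> simp [omegaVar, idx, xIndex]

theorem finite_idx_le (N : ℕ) : {v : Var | idx v ≤ N}.Finite := by
  refine ((((Set.finite_Iic N).image Var.x).union ((Set.finite_Iic N).image Var.y)).union
    ((Set.finite_Iic N).image Var.z)).subset ?_
  rintro (k | k | k) h <;> simpa [idx] using h

theorem IsTame.hasSubst {a : Var → Poly} (ha : IsTame a) :
    MvPowerSeries.HasSubst (fun v => (a v : Series)) := by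
  classical
  obtain ⟨σ, ε, h⟩ := ha
  constructor
  · intro v
    simp [(h v).1]
  · intro d
    refine (finite_idx_le (d.support.sup idx + 1)).subset fun v hv => ?_
    simp only [Set.mem_ofPred_eq, MvPolynomial.coeff_coe, (h v).1, MvPolynomial.coeff_C_mul,
      MvPolynomial.coeff_X] at hv ⊢
    have hd : Finsupp.single (σ v) 1 = d := by
      by_contra hne
      simp [hne] at hv
    refine (h v).2.1.trans (Nat.add_le_add_right (Finset.le_sup (f := idx) ?_) 1)
    simp [← hd]

theorem IsTame.coeff_subst {a : Var → Poly} (ha : IsTame a) {f g : Series} {m : Var →₀ ℕ}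
    (hfg : ∀ d, xBound d ≤ xBound m + 1 → MvPowerSeries.coeff d f = MvPowerSeries.coeff d g) :
    MvPowerSeries.coeff m (MvPowerSeries.substAlgHom ha.hasSubst f) =
      MvPowerSeries.coeff m (MvPowerSeries.substAlgHom ha.hasSubst g) := by
  classical
  rw [MvPowerSeries.substAlgHom_apply, MvPowerSeries.substAlgHom_apply,
    MvPowerSeries.coeff_subst ha.hasSubst, MvPowerSeries.coeff_subst ha.hasSubst]
  refine finsum_congr fun d => ?_
  by_cases hd : xBound d ≤ xBound m + 1
  · rw [hfg d hd]
  suffices h0 : MvPowerSeries.coeff m (d.prod fun v e => (a v : Series) ^ e) = 0 by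
    simp only [h0, smul_zero]
  obtain ⟨σ, ε, h⟩ := ha
  have hprod : (d.prod fun v e => (a v : Series) ^ e) =
      ((MvPolynomial.monomial (d.mapDomain σ) (d.prod fun v e => ε v ^ e) : Poly) : Series) := by
    rw [MvPolynomial.monomial_eq, Finsupp.prod_mapDomain_index (by simp) (by intros; ring)]
    simp only [Finsupp.prod, (h _).1, map_prod, ← MvPolynomial.coe_pow, mul_pow,
      map_pow]
    rw [← Finset.prod_mul_distrib]
    simp only [← MvPolynomial.coeToMvPowerSeries.ringHom_apply, map_prod]
  rw [hprod, MvPolynomial.coeff_coe, MvPolynomial.coeff_monomial, if_neg]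
  rintro rfl
  refine hd (Finset.sup_le fun v hv => (h v).2.2.trans (Nat.add_le_add_right
    (Finset.le_sup (f := xIndex) ?_) 1))
  rw [Finsupp.mem_support_iff] at hv ⊢
  intro h0
  rw [Finsupp.mapDomain, Finsupp.sum_apply, Finsupp.sum, Finset.sum_eq_zero_iff] at h0
  exact hv (by simpa using h0 v (Finsupp.mem_support_iff.2 hv))

theorem xBound_mono {d m : Var →₀ ℕ} (h : d ≤ m) : xBound d ≤ xBound m :=
  Finset.sup_mono (Finsupp.support_mono h)

theorem apply_eq_zero_of_xBound_le {d : Var →₀ ℕ} {N : ℕ} (h : xBound d ≤ N) :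
    d (Var.x N) = 0 := by
  by_contra hne
  have := (Finset.le_sup (f := xIndex) (Finsupp.mem_support_iff.2 hne)).trans h
  simp [xIndex] at this

/-- The coefficients of `(1 + a t) / (1 - a t)`. -/
def qFactorCoeff (a : Poly) (r : ℕ) : Poly := if r = 0 then 1 else 2 * a ^ r

theorem coeff_qFactor (a : Poly) (r : ℕ) :
    PowerSeries.coeff r (qFactor a) = qFactorCoeff a r := by
  rw [qFactor, add_mul, one_mul, mul_assoc, map_add, PowerSeries.coeff_C_mul, PowerSeries.coeff_mk]
  cases r with
  | zero => simp [qFactorCoeff]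
  | succ r => rw [PowerSeries.coeff_succ_X_mul, PowerSeries.coeff_mk]; simp [qFactorCoeff]; ring

theorem qPoly_succ (r N : ℕ) : qPoly r (N + 1) = ∑ p ∈ Finset.HasAntidiagonal.antidiagonal r,
    qPoly p.1 N * qFactorCoeff (MvPolynomial.X (Var.x N)) p.2 := by
  simp only [qPoly, Finset.prod_range_succ, PowerSeries.coeff_mul, coeff_qFactor]

theorem coeff_qPoly_succ (r : ℕ) {N : ℕ} {d : Var →₀ ℕ} (h : xBound d ≤ N) :
    MvPolynomial.coeff d (qPoly r (N + 1)) = MvPolynomial.coeff d (qPoly r N) := by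
  classical
  rw [qPoly_succ, MvPolynomial.coeff_sum, Finset.sum_eq_single (r, 0)]
  · simp [qFactorCoeff]
  · rintro ⟨i, j⟩ hij hne
    have hj : j ≠ 0 := by
      rintro rfl
      simp at hij
      simp [hij] at hne
    obtain ⟨j, rfl⟩ := Nat.exists_eq_succ_of_ne_zero hj
    simp only [qFactorCoeff, if_neg hj]
    rw [Nat.succ_eq_add_one, pow_succ, ← mul_assoc, ← mul_assoc, MvPolynomial.coeff_mul_X',
      if_neg]
    rw [Finsupp.mem_support_iff, not_not]
    exact apply_eq_zero_of_xBound_le h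
  · simp

theorem coeff_q (r : ℕ) {N : ℕ} {d : Var →₀ ℕ} (h : xBound d ≤ N) :
    MvPowerSeries.coeff d (q r) = MvPolynomial.coeff d (qPoly r N) := by
  change MvPolynomial.coeff d (qPoly r (xBound d)) = _
  induction N, h using Nat.le_induction with
  | base => rfl
  | succ N h ih => rw [ih, coeff_qPoly_succ r h]

theorem aeval_qPoly (a : Var → Poly) (r N : ℕ) : MvPolynomial.aeval a (qPoly r N) =
    PowerSeries.coeff r (∏ i ∈ Finset.range N, qFactor (a (Var.x i))) := by
  rw [qPoly]
  have := PowerSeries.coeff_map (MvPolynomial.aeval a : Poly →ₐ[ℤ] Poly).toRingHom r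
    (∏ i ∈ Finset.range N, qFactor (MvPolynomial.X (Var.x i)))
  rw [map_prod] at this
  refine this.symm.trans ?_
  congr 1
  refine Finset.prod_congr rfl fun i _ => ?_
  ext1 k
  rw [PowerSeries.coeff_map, coeff_qFactor, coeff_qFactor]
  rcases eq_or_ne k 0 with rfl | hk
  · simp [qFactorCoeff]
  · simp [qFactorCoeff, hk, map_ofNat]

theorem IsTame.coeff_subst_q {a : Var → Poly} (ha : IsTame a) (r : ℕ) (m : Var →₀ ℕ) :
    MvPowerSeries.coeff m (MvPowerSeries.substAlgHom ha.hasSubst (q r)) =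
      MvPolynomial.coeff m (PowerSeries.coeff r
        (∏ i ∈ Finset.range (xBound m + 1), qFactor (a (Var.x i)))) := by
  rw [ha.coeff_subst (g := (qPoly r (xBound m + 1) : Series)) fun d hd => by
      rw [coeff_q r hd, MvPolynomial.coeff_coe],
    MvPowerSeries.substAlgHom_coe, ← aeval_qPoly, ← MvPolynomial.coeff_coe]
  congr 1
  induction qPoly r (xBound m + 1) using MvPolynomial.induction_on with
  | C c =>
    rw [← MvPolynomial.algebraMap_eq, AlgHom.commutes, AlgHom.commutes,
      MvPolynomial.algebraMap_eq, MvPolynomial.coe_C]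
    rfl
  | add p q hp hq => simp only [map_add, hp, hq, MvPolynomial.coe_add]
  | mul_X p v hp => simp only [map_mul, hp, MvPolynomial.aeval_X, MvPolynomial.coe_mul]

/-- The ring endomorphism `f(X; Y, Z) ↦ f(s_i(X; Y, Z))` of the ring of formal power series. -/
def reflSeries (i : ℕ) : Series →ₐ[ℤ] Series :=
  MvPowerSeries.substAlgHom (isTame_reflVar i).hasSubst

/-- The ring endomorphism `ω` of the ring of formal power series. -/
def omegaSeries : Series →ₐ[ℤ] Series :=
  MvPowerSeries.substAlgHom isTame_omegaVar.hasSubst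

theorem reflSeries_X (i : ℕ) (v : Var) :
    reflSeries i (MvPowerSeries.X v) = (reflVar i v : Series) :=
  MvPowerSeries.substAlgHom_X _ v

theorem omegaSeries_X (v : Var) : omegaSeries (MvPowerSeries.X v) = (omegaVar v : Series) :=
  MvPowerSeries.substAlgHom_X _ v

theorem reflSeries_succ_q (i r : ℕ) : reflSeries (i + 1) (q r) = q r := by
  ext m
  rw [reflSeries, (isTame_reflVar _).coeff_subst_q, coeff_q r (Nat.le_succ _)]
  rfl

theorem omegaSeries_q (r : ℕ) : omegaSeries (q r) = q r := by
  ext m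
  rw [omegaSeries, isTame_omegaVar.coeff_subst_q, coeff_q r (Nat.le_succ _)]
  rfl

theorem reflSeries_zero_q_aux (r : ℕ) : reflSeries 0 (q r) = ∑ p ∈ Finset.HasAntidiagonal.antidiagonal r,
    q p.1 * (qFactorCoeff (MvPolynomial.X (Var.y 0)) p.2 : Series) := by
  classical
  ext m
  rw [reflSeries, (isTame_reflVar _).coeff_subst_q, Finset.prod_range_succ', PowerSeries.coeff_mul, map_sum,
    MvPolynomial.coeff_sum]
  refine Finset.sum_congr rfl fun p _ => ?_
  rw [coeff_qFactor, MvPowerSeries.coeff_mul, MvPolynomial.coeff_mul]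
  refine Finset.sum_congr rfl fun d hd => ?_
  rw [coeff_q p.1 (xBound_mono (le_iff_exists_add.2 ⟨d.2, (Finset.HasAntidiagonal.mem_antidiagonal.1 hd).symm⟩)), MvPolynomial.coeff_coe]
  rfl

theorem q_zero : q 0 = 1 := by
  ext m
  rw [coeff_q 0 le_rfl, ← MvPolynomial.coe_one, MvPolynomial.coeff_coe]
  congr 1
  generalize xBound m = N
  induction N with
  | zero => simp [qPoly]
  | succ N ih => rw [qPoly_succ]; simp [ih, qFactorCoeff]

/-- `s_0(q_r(X)) = q_r(X) + 2 ∑_{j=1}^r y_1^j q_{r-j}(X)`. -/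
theorem reflSeries_zero_q (r : ℕ) : reflSeries 0 (q r) =
    q r + 2 * ∑ j ∈ Finset.Icc 1 r, MvPowerSeries.X (Var.y 0) ^ j * q (r - j) := by
  rw [reflSeries_zero_q_aux, ← Finset.Nat.sum_antidiagonal_swap,
    Finset.Nat.sum_antidiagonal_eq_sum_range_succ_mk, Finset.sum_range_succ', add_comm,
    Finset.range_eq_Ico, Finset.sum_Ico_add' (fun j => q (Prod.swap (j, r - j)).1 *
      (qFactorCoeff (MvPolynomial.X (Var.y 0)) (Prod.swap (j, r - j)).2 : Series)) 0 r 1,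
    Finset.mul_sum]
  congr 1
  · simp [qFactorCoeff]
  · refine Finset.sum_congr (by ext; simp) fun j hj => ?_
    have : j ≠ 0 := by simp at hj; omega
    have h2 : (((2 : Poly)) : Series) = 2 :=
      map_ofNat (MvPolynomial.coeToMvPowerSeries.ringHom (σ := Var) (R := ℤ)) 2
    simp [qFactorCoeff, this, h2]
    ring

theorem q_mem (r : ℕ) : q r ∈ GammaYZ := Algebra.subset_adjoin (.inl (.inl ⟨r, rfl⟩))

theorem y_mem (j : ℕ) : MvPowerSeries.X (Var.y j) ∈ GammaYZ :=
  Algebra.subset_adjoin (.inl (.inr ⟨j, rfl⟩))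

theorem z_mem (j : ℕ) : MvPowerSeries.X (Var.z j) ∈ GammaYZ :=
  Algebra.subset_adjoin (.inr ⟨j, rfl⟩)

theorem mem_of_generators (φ : Series →ₐ[ℤ] Series) (hq : ∀ r, φ (q r) ∈ GammaYZ)
    (hy : ∀ j, φ (MvPowerSeries.X (Var.y j)) ∈ GammaYZ)
    (hz : ∀ j, φ (MvPowerSeries.X (Var.z j)) ∈ GammaYZ) (f : GammaYZ) : φ f ∈ GammaYZ := by
  have h : GammaYZ ≤ GammaYZ.comap φ := by
    refine Algebra.adjoin_le ?_
    rintro _ ((⟨r, rfl⟩ | ⟨j, rfl⟩) | ⟨j, rfl⟩)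
    exacts [hq r, hy j, hz j]
  exact h f.2

theorem coe_X_var (v : Var) : ((MvPolynomial.X v : Poly) : Series) = MvPowerSeries.X v :=
  MvPolynomial.coe_X v

theorem coe_neg_X_var (v : Var) : ((-MvPolynomial.X v : Poly) : Series) = -MvPowerSeries.X v := by
  rw [← MvPolynomial.coeToMvPowerSeries.ringHom_apply, map_neg,
    MvPolynomial.coeToMvPowerSeries.ringHom_apply, coe_X_var]

theorem reflSeries_mem (i : ℕ) (f : GammaYZ) : reflSeries i f ∈ GammaYZ := by
  cases i with
  | zero =>
    refine mem_of_generators _ (fun r => ?_) (fun j => ?_) (fun j => ?_) f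
    · rw [reflSeries_zero_q]
      exact add_mem (q_mem r) (mul_mem (ofNat_mem _ 2)
        (sum_mem fun j _ => mul_mem (pow_mem (y_mem 0) j) (q_mem _)))
    · rw [reflSeries_X]
      cases j with
      | zero => simpa only [reflVar, coe_neg_X_var] using neg_mem (y_mem 0)
      | succ j => simpa only [reflVar, coe_X_var] using y_mem (j + 1)
    · simpa only [reflSeries_X, reflVar, coe_X_var] using z_mem j
  | succ i =>
    refine mem_of_generators _ (fun r => ?_) (fun j => ?_) (fun j => ?_) f
    · simpa only [reflSeries_succ_q] using q_mem r
    · simpa only [reflSeries_X, reflVar, coe_X_var] using y_mem _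
    · simpa only [reflSeries_X, reflVar, coe_X_var] using z_mem j

theorem omegaSeries_mem (f : GammaYZ) : omegaSeries f ∈ GammaYZ := by
  refine mem_of_generators _ (fun r => ?_) (fun j => ?_) (fun j => ?_) f
  · simpa only [omegaSeries_q] using q_mem r
  · simpa only [omegaSeries_X, omegaVar, coe_neg_X_var] using neg_mem (z_mem j)
  · simpa only [omegaSeries_X, omegaVar, coe_neg_X_var] using neg_mem (y_mem j)

/-- The action of `s_i` on `Γ[Y,Z]`. -/
def refl (i : ℕ) : GammaYZ →ₐ[ℤ] GammaYZ :=
  ((reflSeries i).comp GammaYZ.val).codRestrict GammaYZ (reflSeries_mem i)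

/-- The involution `ω` of `Γ[Y,Z]`: `y_j ↦ -z_j`, `z_j ↦ -y_j`, `q_r(X) ↦ q_r(X)`. -/
def omega : GammaYZ →ₐ[ℤ] GammaYZ :=
  (omegaSeries.comp GammaYZ.val).codRestrict GammaYZ omegaSeries_mem

/-- The variable `y_{j+1}`, as an element of `Γ[Y,Z]`. -/
def yVar (j : ℕ) : GammaYZ := ⟨MvPowerSeries.X (Var.y j), y_mem j⟩

/-- The denominators of the divided differences: `-2 y_1` for `i = 0`, and `y_i - y_{i+1}` for
`i ≥ 1`. -/
def denom : ℕ → GammaYZ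
  | 0 => -2 * yVar 0
  | k + 1 => yVar k - yVar (k + 1)

theorem denom_ne_zero (i : ℕ) : denom i ≠ 0 := by
  classical
  intro h
  cases i with
  | zero =>
    have h' := congrArg (fun f : GammaYZ => MvPowerSeries.coeff (Finsupp.single (Var.y 0) 1)
      (f : Series)) h
    have h2 : (-2 : Series) = MvPowerSeries.C (-2 : ℤ) := by
      rw [map_neg, map_ofNat]
    simp only [denom, yVar] at h'
    change MvPowerSeries.coeff (Finsupp.single (Var.y 0) 1)
      ((-2 : Series) * MvPowerSeries.X (Var.y 0)) = 0 at h'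
    rw [h2, MvPowerSeries.coeff_C_mul, MvPowerSeries.coeff_X] at h'
    simp at h'
  | succ k =>
    have h' := congrArg (fun f : GammaYZ => MvPowerSeries.coeff (Finsupp.single (Var.y k) 1)
      (f : Series)) h
    change MvPowerSeries.coeff (Finsupp.single (Var.y k) 1)
      ((MvPowerSeries.X (Var.y k) : Series) - MvPowerSeries.X (Var.y (k + 1))) = 0 at h'
    rw [map_sub, MvPowerSeries.coeff_X, MvPowerSeries.coeff_X] at h'
    simp [Finsupp.single_left_inj] at h'

theorem generator_divisible (i : ℕ) {f : Series} (hf : f ∈ Set.range q ∪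
    Set.range (fun j => MvPowerSeries.X (Var.y j)) ∪ Set.range fun j => MvPowerSeries.X (Var.z j)) :
    ∃ g : GammaYZ, (denom i : Series) * g = f - reflSeries i f := by
  rcases hf with (⟨r, rfl⟩ | ⟨j, rfl⟩) | ⟨j, rfl⟩
  · cases i with
    | zero =>
      refine ⟨∑ j ∈ Finset.Icc 1 r, yVar 0 ^ (j - 1) * ⟨q (r - j), q_mem _⟩, ?_⟩
      change (-2 * MvPowerSeries.X (Var.y 0) : Series) * GammaYZ.val _ = _
      simp only [reflSeries_zero_q, map_sum, map_mul, map_pow, Subalgebra.coe_val, yVar]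
      rw [sub_add_cancel_left, mul_assoc, neg_mul, Finset.mul_sum]
      congr 2
      refine Finset.sum_congr rfl fun j hj => ?_
      rw [← mul_assoc, ← pow_succ', Nat.sub_add_cancel (Finset.mem_Icc.1 hj).1]
    | succ i => exact ⟨0, by simp [reflSeries_succ_q]⟩
  · rw [reflSeries_X]
    cases i with
    | zero =>
      cases j with
      | zero =>
        refine ⟨-1, ?_⟩
        simp only [reflVar, coe_neg_X_var]
        change (-2 * MvPowerSeries.X (Var.y 0) : Series) * (-1) = _
        ring
      | succ j => exact ⟨0, by simp [reflVar]⟩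
    | succ i =>
      simp only [reflVar, coe_X_var]
      change ∃ g : GammaYZ, (MvPowerSeries.X (Var.y i) - MvPowerSeries.X (Var.y (i + 1)) : Series) *
        (g : Series) = _
      rw [Equiv.swap_apply_def]
      split_ifs with h₁ h₂
      · exact ⟨1, by simp [h₁]⟩
      · exact ⟨-1, by simp [h₂]⟩
      · exact ⟨0, by simp⟩
  · refine ⟨0, ?_⟩
    rw [reflSeries_X]
    cases i <;> simp [reflVar]

theorem exists_divDiff (i : ℕ) (f : GammaYZ) : ∃ g : GammaYZ, denom i * g = f - refl i f := by
  obtain ⟨f, hf⟩ := f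
  suffices h : ∃ g : GammaYZ, (denom i : Series) * g = f - reflSeries i f by
    obtain ⟨g, hg⟩ := h
    exact ⟨g, Subtype.ext hg⟩
  induction hf using Algebra.adjoin_induction with
  | mem f hf => exact generator_divisible i hf
  | algebraMap c => exact ⟨0, by simp⟩
  | add f g hf hg hf' hg' =>
    obtain ⟨a, ha⟩ := hf'
    obtain ⟨b, hb⟩ := hg'
    exact ⟨a + b, by rw [map_add, Subalgebra.coe_add, mul_add, ha, hb]; ring⟩
  | mul f g hf hg hf' hg' =>
    obtain ⟨a, ha⟩ := hf'
    obtain ⟨b, hb⟩ := hg'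
    refine ⟨a * ⟨g, hg⟩ + refl i ⟨f, hf⟩ * b, ?_⟩
    change (denom i : Series) * ((a : Series) * g + reflSeries i f * b) = _
    rw [map_mul]
    linear_combination g * ha + reflSeries i f * hb

/-- The divided difference operator `∂_i^y` on `Γ[Y,Z]`: the quotient of `f - s_i f` by `-2 y_1` if
`i = 0`, and by `y_i - y_{i+1}` if `i ≥ 1`. -/
def divDiffY (i : ℕ) (f : GammaYZ) : GammaYZ := (exists_divDiff i f).choose

theorem denom_mul_divDiffY (i : ℕ) (f : GammaYZ) : denom i * divDiffY i f = f - refl i f :=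
  (exists_divDiff i f).choose_spec

theorem divDiffY_eq_iff (i : ℕ) (f g : GammaYZ) :
    divDiffY i f = g ↔ denom i * g = f - refl i f := by
  rw [← denom_mul_divDiffY]
  exact ⟨fun h => h ▸ rfl, fun h => (mul_left_cancel₀ (denom_ne_zero i) h).symm⟩

/-- The divided difference operator `∂_i^z = ω ∂_i^y ω` on `Γ[Y,Z]`. -/
def divDiffZ (i : ℕ) (f : GammaYZ) : GammaYZ := omega (divDiffY i (omega f))

section schubert

/-- `A_i(t) = (1 + t u_{n-1}) (1 + t u_{n-2}) ⋯ (1 + t u_i)`. -/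
def A (n i : ℕ) (t : Poly) : NilCoxeter Poly n :=
  (((List.finRange n).filter fun j : Fin n => i ≤ (j : ℕ)).reverse.map fun j => 1 + t • u Poly j).prod

/-- `Ã_i(t) = (1 - t u_i) (1 - t u_{i+1}) ⋯ (1 - t u_{n-1})`. -/
def ATilde (n i : ℕ) (t : Poly) : NilCoxeter Poly n :=
  (((List.finRange n).filter fun j : Fin n => i ≤ (j : ℕ)).map fun j => 1 - t • u Poly j).prod

/-- `C(t) = (1 + t u_{n-1}) ⋯ (1 + t u_1) (1 + t u_0) (1 + t u_0) (1 + t u_1) ⋯ (1 + t u_{n-1})`. -/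
def CFactor (n : ℕ) (t : Poly) : NilCoxeter Poly n :=
  ((List.finRange n).reverse.map fun j => 1 + t • u Poly j).prod *
    ((List.finRange n).map fun j => 1 + t • u Poly j).prod

/-- The product `Ã_{n-1}(z_{n-1}) ⋯ Ã_1(z_1) C(x_1) ⋯ C(x_N) A_1(y_1) ⋯ A_{n-1}(y_{n-1})`. -/
def schubertProduct (n N : ℕ) : NilCoxeter Poly n :=
  ((List.range (n - 1)).reverse.map fun j => ATilde n (j + 1) (MvPolynomial.X (.z j))).prod *
    ((List.range N).map fun j => CFactor n (MvPolynomial.X (.x j))).prod *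
    ((List.range (n - 1)).map fun j => A n (j + 1) (MvPolynomial.X (.y j))).prod

/-- The type C double Schubert polynomial of `w ∈ W_n`, computed in the nilCoxeter algebra of
`W_n`: the coefficient of `u_w` in
`Ã_{n-1}(z_{n-1}) ⋯ Ã_1(z_1) C(x_1) C(x_2) ⋯ A_1(y_1) ⋯ A_{n-1}(y_{n-1})`. -/
def schubertAt (n : ℕ) (w : SignedPerm) : Series := xLimit fun N => coeff w (schubertProduct n N)

/-- The least `n` such that `w ∈ W_n`. -/
def rank (w : SignedPerm) : ℕ := sInf {n | w ∈ finiteW n}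

/-- The type C double Schubert polynomial of `w ∈ W_∞`, computed in the nilCoxeter algebra of the
smallest `W_n` that contains `w`. -/
def schubert (w : SignedPerm) : Series := schubertAt (rank w) w

end schubert

/-- The divided difference equations, with the normalization of the constant terms, for a family of
elements of `Γ[Y,Z]` indexed by `W_∞`. -/
structure IsSchubertFamily (F : SignedPerm → GammaYZ) : Prop where
  divDiffY_of_lt (i : ℕ) (w : SignedPerm) (h : length (w * s i) < length w) :
    divDiffY i (F w) = F (w * s i)
  divDiffY_of_not_lt (i : ℕ) (w : SignedPerm) (h : ¬ length (w * s i) < length w) :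
    divDiffY i (F w) = 0
  divDiffZ_of_lt (i : ℕ) (w : SignedPerm) (h : length (s i * w) < length w) :
    divDiffZ i (F w) = F (s i * w)
  divDiffZ_of_not_lt (i : ℕ) (w : SignedPerm) (h : ¬ length (s i * w) < length w) :
    divDiffZ i (F w) = 0
  constantCoeff_one : MvPowerSeries.constantCoeff (F 1 : Series) = 1
  constantCoeff_of_ne_one (w : SignedPerm) (h : w ≠ 1) :
    MvPowerSeries.constantCoeff (F w : Series) = 0

end TypeC

end

/-!
The series `ℭ_w` are the coefficients of one product `Ã(Z) C(X) A(Y)` in the nilCoxeter algebra, and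
each assertion about them is read off from an identity between such products.

*Divided differences.* The Yang–Baxter equations `yang_baxter` and `yang_baxter_four` for the linear
factors `h_i(t) = 1 + t u_i` imply that the `A_i(t)` commute with each other for fixed `i ≥ 1`, and
that the `C(t)` commute (`IsNilCoxeter.commute_desc`, `IsNilCoxeter.commute_cFactor`). Hence
`A_i(y_i) A_{i+1}(y_{i+1})` changes under `s_i` by its multiple with `(y_i - y_{i+1}) u_i`, and, since
`C(t) A_1(-t) = A_1(t) (1 + 2 t u_0)`, the whole product changes under `s_0` by its multiple with
`-2 y_1 u_0` (`fullProduct_swap_sub`, `fullProduct_zero_sub`). As the coefficient of `u_w` in `h u_i`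
is that of `u_{w s_i}` in `h`, or zero if `w s_i` is longer than `w` (`coeff_mul_u`), these are the
equations for `∂_i^y`. Reversing all words interchanges `y_j` with `-z_j` and `w` with `w⁻¹`, so
`ω ℭ_w = ℭ_{w⁻¹}` (`omegaSeries_schubert`), and the equations for `∂_i^z` follow.

*Independence of `n`.* A reduced word of an element of `W_n` involves only `s_0, …, s_{n-1}`: deleting
from a word the strand of a fixed point that takes part in a crossing would give a shorter word
(`IsReducedWord.lt_of_mem`). So the homomorphism that kills `u_n, u_{n+1}, …` preserves the coefficient
of `u_w` for `w ∈ W_n` (`coeff_nilMap`).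

*Membership in `Γ[Y,Z]`.* The element `E(t) = (C(t) + 1) / 2 = ∑ e_k t ^ k` has integral coefficients,
which commute with each other, and `C(t) C(-t) = 1` gives `C(t) E(-t) = E(t)`. This uses division by
`2` and comparison of coefficients, and is therefore carried out in a torsion-free quotient of the
nilCoxeter algebra that still determines the coefficient of `u_w`. Over an extension ring
`E(t) = ∏_j (1 + a_j t)` with nilpotent `a_j`, so that
`∏_i C(x_i) = ∏_j ∏_i (1 + x_i a_j) / (1 - x_i a_j) = ∏_j ∑_r q_r(X) a_j ^ r`, which is symmetric in
the `a_j` and hence a polynomial in the `e_k` with coefficients in `Γ` (`exists_prod_eq_eval`).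

*Uniqueness.* By induction on the length, the difference of two solutions at `w` is annihilated by all
the `∂_i^y` and `∂_i^z`, that is, invariant under all the `s_i` and their conjugates by `ω`. Only
finitely many `y_j` occur in it, so that none does, by symmetry; likewise for the `z_j`. Finally, `s_0`
replaces `x_1, x_2, …` by `y_1, x_1, x_2, …`; so if `x_k` occurs, then `x_{k-1}` occurs too, and
eventually `y_1`. Thus an invariant element is a constant (`eq_zero_of_invariant`).
-/

noncomputable section

namespace TypeC

/-! ### The Yang–Baxter equations and commuting products -/

section generic

/-- The nilCoxeter relations of types `B` and `C`, for a sequence of elements of a ring. Finitely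
many elements with these relations give such a sequence when they are continued by zeros, because
every relation that involves one of the added zeros reads `0 = 0`. -/
structure IsNilCoxeter {𝒜 : Type*} [Ring 𝒜] (v : ℕ → 𝒜) : Prop where
  sq (i : ℕ) : v i * v i = 0
  comm {i j : ℕ} (h : i + 2 ≤ j) : v i * v j = v j * v i
  braid (i : ℕ) (h : 0 < i) : v i * v (i + 1) * v i = v (i + 1) * v i * v (i + 1)
  four : v 0 * v 1 * v 0 * v 1 = v 1 * v 0 * v 1 * v 0

variable {R 𝒜 : Type*} [CommRing R] [Ring 𝒜] [Algebra R 𝒜]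

/-- The linear factor `h_j(t) = 1 + t v_j`. -/
def lin (v : ℕ → 𝒜) (t : R) (j : ℕ) : 𝒜 := 1 + t • v j

/-- `A_i(t) = h_{n-1}(t) ⋯ h_{i+1}(t) h_i(t)`. -/
def desc (v : ℕ → 𝒜) (n i : ℕ) (t : R) : 𝒜 :=
  ((List.range' i (n - i)).reverse.map (lin v t)).prod

/-- `h_i(t) h_{i+1}(t) ⋯ h_{n-1}(t)`, so that `Ã_i(t)` is `asc v n i (-t)`. -/
def asc (v : ℕ → 𝒜) (n i : ℕ) (t : R) : 𝒜 :=
  ((List.range' i (n - i)).map (lin v t)).prod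

/-- `C(t) = h_{n-1}(t) ⋯ h_0(t) h_0(t) ⋯ h_{n-1}(t)`. -/
def cFactor (v : ℕ → 𝒜) (n : ℕ) (t : R) : 𝒜 := desc v n 0 t * asc v n 0 t

theorem lin_zero_of_eq_zero {v : ℕ → 𝒜} {j : ℕ} (h : v j = 0) (t : R) : lin v t j = 1 := by
  simp [lin, h]

variable {v : ℕ → 𝒜} {n : ℕ}

theorem desc_of_le {i : ℕ} (h : n ≤ i) (t : R) : desc v n i t = 1 := by
  simp [desc, Nat.sub_eq_zero_of_le h]

theorem asc_of_le {i : ℕ} (h : n ≤ i) (t : R) : asc v n i t = 1 := by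
  simp [asc, Nat.sub_eq_zero_of_le h]

theorem desc_eq (h0 : ∀ j, n ≤ j → v j = 0) (i : ℕ) (t : R) :
    desc v n i t = desc v n (i + 1) t * lin v t i := by
  rcases le_or_gt n i with h | h
  · rw [desc_of_le h, desc_of_le (by omega), lin_zero_of_eq_zero (h0 i h), mul_one]
  · obtain ⟨k, rfl⟩ : ∃ k, n = i + 1 + k := ⟨n - (i + 1), by omega⟩
    have h1 : i + 1 + k - i = k + 1 := by omega
    have h2 : i + 1 + k - (i + 1) = k := by omega
    simp [desc, h1, h2, List.range'_succ]

theorem asc_eq (h0 : ∀ j, n ≤ j → v j = 0) (i : ℕ) (t : R) :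
    asc v n i t = lin v t i * asc v n (i + 1) t := by
  rcases le_or_gt n i with h | h
  · rw [asc_of_le h, asc_of_le (by omega), lin_zero_of_eq_zero (h0 i h), mul_one]
  · obtain ⟨k, rfl⟩ : ∃ k, n = i + 1 + k := ⟨n - (i + 1), by omega⟩
    have h1 : i + 1 + k - i = k + 1 := by omega
    have h2 : i + 1 + k - (i + 1) = k := by omega
    simp [asc, h1, h2, List.range'_succ]

/-- Downward induction on `i ≤ n`. -/
theorem downward_induction (n : ℕ) {P : ℕ → Prop} (hb : ∀ i, n ≤ i → P i)
    (hs : ∀ i, (∀ j, i < j → P j) → P i) (i : ℕ) : P i := by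
  by_cases h : n ≤ i
  · exact hb i h
  · exact hs i fun j hj => downward_induction n hb hs j
termination_by n - i

namespace IsNilCoxeter

variable (hv : IsNilCoxeter v)
include hv

theorem lin_mul_lin (s t : R) (j : ℕ) : lin v s j * lin v t j = lin v (s + t) j := by
  simp only [lin, mul_add, add_mul, smul_mul_assoc, mul_smul_comm, one_mul, mul_one, hv.sq]
  module

theorem lin_mul_lin_neg (t : R) (j : ℕ) : lin v t j * lin v (-t) j = 1 := by
  rw [hv.lin_mul_lin]; simp [lin]

theorem lin_neg_mul_lin (t : R) (j : ℕ) : lin v (-t) j * lin v t j = 1 := by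
  rw [hv.lin_mul_lin]; simp [lin]

theorem commute_v_lin {i j : ℕ} (h : i + 2 ≤ j) (t : R) : Commute (v i) (lin v t j) :=
  (Commute.one_right _).add_right (Commute.smul_right (hv.comm h) t)

theorem commute_v_desc {i j : ℕ} (h : i + 2 ≤ j) (t : R) : Commute (v i) (desc v n j t) := by
  refine Commute.list_prod_right _ _ fun x hx => ?_
  simp only [List.mem_map, List.mem_reverse, List.mem_range'_1] at hx
  obtain ⟨k, hk, rfl⟩ := hx
  exact hv.commute_v_lin (by omega) t

theorem commute_lin_desc {i j : ℕ} (h : i + 2 ≤ j) (s t : R) :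
    Commute (lin v s i) (desc v n j t) :=
  (Commute.one_left _).add_left ((hv.commute_v_desc h t).smul_left s)

theorem commute_v_asc {i j : ℕ} (h : i + 2 ≤ j) (t : R) : Commute (v i) (asc v n j t) := by
  refine Commute.list_prod_right _ _ fun x hx => ?_
  simp only [List.mem_map, List.mem_range'_1] at hx
  obtain ⟨k, hk, rfl⟩ := hx
  exact hv.commute_v_lin (by omega) t

theorem commute_lin_asc {i j : ℕ} (h : i + 2 ≤ j) (s t : R) :
    Commute (lin v s i) (asc v n j t) :=
  (Commute.one_left _).add_left ((hv.commute_v_asc h t).smul_left s)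

/-- The Yang–Baxter equation of type `A_2`. -/
theorem yang_baxter {i : ℕ} (hi : 0 < i) (x y : R) :
    lin v (x - y) (i + 1) * lin v x i * lin v y (i + 1) =
      lin v y i * lin v x (i + 1) * lin v (x - y) i := by
  have hb := hv.braid i hi
  have s0 := hv.sq i
  have s1 := hv.sq (i + 1)
  simp only [lin]
  generalize v i = a at *
  generalize v (i + 1) = b at *
  simp only [mul_add, add_mul, smul_mul_assoc, mul_smul_comm, one_mul, mul_one, s0, s1, hb,
    smul_zero, add_zero]
  module

/-- The Yang–Baxter equation of type `B_2`. -/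
theorem yang_baxter_four (x y : R) :
    lin v (x - y) 1 * lin v (2 * x) 0 * lin v (x + y) 1 * lin v (2 * y) 0 =
      lin v (2 * y) 0 * lin v (x + y) 1 * lin v (2 * x) 0 * lin v (x - y) 1 := by
  have hb := hv.four
  have s0 := hv.sq 0
  have s1 := hv.sq 1
  have s0' (c) : c * v 0 * v 0 = 0 := by rw [mul_assoc, s0, mul_zero]
  have s1' (c) : c * v 1 * v 1 = 0 := by rw [mul_assoc, s1, mul_zero]
  simp only [lin]
  generalize v 0 = a at *
  generalize v 1 = b at *
  simp only [mul_add, add_mul, smul_mul_assoc, mul_smul_comm, one_mul, mul_one, s0, s1, s0', s1',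
    hb, smul_zero, add_zero]
  module

variable (h0 : ∀ j, n ≤ j → v j = 0)
include h0

theorem desc_mul_asc_neg (i : ℕ) (t : R) : desc v n i t * asc v n i (-t) = 1 := by
  induction i using downward_induction n with
  | hb i h => rw [desc_of_le h, asc_of_le h, mul_one]
  | hs i ih =>
    rw [desc_eq h0, asc_eq h0, mul_assoc, ← mul_assoc (lin v t i), hv.lin_mul_lin_neg, one_mul,
      ih _ (Nat.lt_succ_self i)]

theorem asc_mul_desc_neg (i : ℕ) (t : R) : asc v n i t * desc v n i (-t) = 1 := by
  induction i using downward_induction n with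
  | hb i h => rw [desc_of_le h, asc_of_le h, mul_one]
  | hs i ih =>
    rw [desc_eq h0, asc_eq h0, mul_assoc, ← mul_assoc (asc v n _ t), ih _ (Nat.lt_succ_self i),
      one_mul, hv.lin_mul_lin_neg]

/-- `A_i(x)` and `A_i(y)` commute, for `i ≥ 1`. -/
theorem commute_desc {i : ℕ} (hi : 0 < i) (x y : R) :
    Commute (desc v n i x) (desc v n i y) := by
  induction i using downward_induction n with
  | hb i h => rw [desc_of_le h]; exact Commute.one_left _
  | hs i ih =>
    -- Both products are `A_{i+1}(y) A_{i+2}(x)` times factors `h_i`, `h_{i+1}`; these factors are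
    -- the two sides of the Yang–Baxter equation, times `h_i(y)`.
    have e : desc v n (i + 1) x * desc v n (i + 2) y =
        desc v n (i + 1) y * desc v n (i + 2) x * lin v (x - y) (i + 1) := by
      have h1 := ih (i + 1) (Nat.lt_succ_self i) (Nat.succ_pos i)
      calc desc v n (i + 1) x * desc v n (i + 2) y
          = desc v n (i + 1) x * desc v n (i + 1) y * lin v (-y) (i + 1) := by
            rw [desc_eq h0 (i + 1) y]
            simp only [mul_assoc, hv.lin_mul_lin_neg, mul_one]
        _ = desc v n (i + 1) y * desc v n (i + 2) x * lin v (x - y) (i + 1) := by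
            rw [h1.eq, desc_eq h0 (i + 1) x]
            simp only [mul_assoc, hv.lin_mul_lin, sub_eq_add_neg]
    have c1 := hv.commute_lin_desc (R := R) (n := n) (i := i) (j := i + 2) le_rfl
    calc desc v n i x * desc v n i y
        = desc v n (i + 1) x * (lin v x i * desc v n (i + 2) y) * lin v y (i + 1) * lin v y i := by
          rw [desc_eq h0 i, desc_eq h0 i, desc_eq h0 (i + 1) y]; simp only [mul_assoc]
      _ = desc v n (i + 1) x * desc v n (i + 2) y * lin v x i * lin v y (i + 1) * lin v y i := by
          rw [(c1 x y).eq]; simp only [mul_assoc]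
      _ = desc v n (i + 1) y * desc v n (i + 2) x *
            (lin v (x - y) (i + 1) * lin v x i * lin v y (i + 1)) * lin v y i := by
          rw [e]; simp only [mul_assoc]
      _ = desc v n (i + 1) y * (desc v n (i + 2) x * lin v y i) * lin v x (i + 1) *
            (lin v (x - y) i * lin v y i) := by
          rw [hv.yang_baxter hi]; simp only [mul_assoc]
      _ = desc v n (i + 1) y * lin v y i * (desc v n (i + 2) x * lin v x (i + 1)) *
            lin v x i := by
          rw [← (c1 y x).eq, hv.lin_mul_lin, sub_add_cancel]; simp only [mul_assoc]
      _ = desc v n i y * desc v n i x := by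
          rw [desc_eq h0 i, desc_eq h0 i, desc_eq h0 (i + 1) x]; simp only [mul_assoc]

theorem desc_mul_desc_succ {i : ℕ} (hi : 0 < i) (x y : R) :
    desc v n i x * desc v n (i + 1) y =
      desc v n i y * desc v n (i + 1) x * lin v (x - y) i := by
  calc desc v n i x * desc v n (i + 1) y
      = desc v n i x * desc v n i y * lin v (-y) i := by
        rw [desc_eq h0 i y]
        simp only [mul_assoc, hv.lin_mul_lin_neg, mul_one]
    _ = desc v n i y * desc v n (i + 1) x * lin v (x - y) i := by
        rw [(hv.commute_desc h0 hi x y).eq, desc_eq h0 i x]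
        simp only [mul_assoc, hv.lin_mul_lin, sub_eq_add_neg]

/-- The divided difference of `A_i(x) A_{i+1}(y)` is its product with `v_i`. -/
theorem desc_mul_desc_sub {i : ℕ} (hi : 0 < i) (x y : R) :
    desc v n i x * desc v n (i + 1) y - desc v n i y * desc v n (i + 1) x =
      (x - y) • (desc v n i x * desc v n (i + 1) y * v i) := by
  rw [hv.desc_mul_desc_succ h0 hi y x]
  simp only [lin, mul_add, mul_one, mul_smul_comm]
  module

theorem commute_asc {i : ℕ} (hi : 0 < i) (x y : R) :
    Commute (asc v n i x) (asc v n i y) := by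
  have inv (t : R) : desc v n i (-t) * asc v n i t = 1 := by
    simpa using hv.desc_mul_asc_neg h0 i (-t)
  have inv' (t : R) : asc v n i t * desc v n i (-t) = 1 := hv.asc_mul_desc_neg h0 i t
  let f (t : R) : 𝒜ˣ := ⟨asc v n i t, desc v n i (-t), inv' t, inv t⟩
  have h : Commute (f x)⁻¹ (f y)⁻¹ := Units.ext (hv.commute_desc h0 hi (-x) (-y))
  exact congrArg Units.val h.inv_inv.eq

theorem commute_asc_desc {i : ℕ} (hi : 0 < i) (x y : R) :
    Commute (asc v n i x) (desc v n i y) := by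
  have inv (t : R) : desc v n i (-t) * asc v n i t = 1 := by
    simpa using hv.desc_mul_asc_neg h0 i (-t)
  have inv' (t : R) : asc v n i t * desc v n i (-t) = 1 := hv.asc_mul_desc_neg h0 i t
  let f (t : R) : 𝒜ˣ := ⟨asc v n i t, desc v n i (-t), inv' t, inv t⟩
  have h : Commute (↑(f x)⁻¹ : 𝒜) (desc v n i y) := hv.commute_desc h0 hi (-x) y
  exact Commute.units_inv_left_iff.1 h

/-- The two middle factors of `C(t)` combine, as `v_0` has square zero. -/
theorem cFactor_eq (t : R) : cFactor v n t = desc v n 1 t * lin v (2 * t) 0 * asc v n 1 t := by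
  rw [cFactor, desc_eq h0, asc_eq h0]
  simp only [mul_assoc]
  rw [← mul_assoc (lin v t 0), hv.lin_mul_lin, two_mul]

theorem cFactor_mul_neg (t : R) : cFactor v n t * cFactor v n (-t) = 1 := by
  rw [hv.cFactor_eq h0, hv.cFactor_eq h0]
  simp only [mul_assoc]
  rw [← mul_assoc (asc v n 1 t), hv.asc_mul_desc_neg h0, one_mul, ← mul_assoc (lin v (2 * t) 0),
    mul_neg, hv.lin_mul_lin_neg, one_mul, hv.desc_mul_asc_neg h0]

/-- `C(t) A_1(-t) = A_1(t) (1 + 2 t v_0)`. -/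
theorem cFactor_mul_desc_neg (t : R) :
    cFactor v n t * desc v n 1 (-t) = desc v n 1 t * lin v (2 * t) 0 := by
  rw [hv.cFactor_eq h0, mul_assoc, hv.asc_mul_desc_neg h0, mul_one]

/-- `C(x)` and `C(y)` commute. -/
theorem commute_cFactor (x y : R) : Commute (cFactor v n x) (cFactor v n y) := by
  have c01 (s t : R) := hv.commute_lin_desc (n := n) (i := 0) (j := 2) le_rfl s t
  have c01' (s t : R) := hv.commute_lin_asc (n := n) (i := 0) (j := 2) le_rfl s t
  have e1 : desc v n 1 x * desc v n 2 y = desc v n 1 y * desc v n 2 x * lin v (x - y) 1 :=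
    hv.desc_mul_desc_succ h0 one_pos x y
  -- The reversed identity, obtained by inverting `e1` with `-x`, `-y` in place of `x`, `y`.
  have e2 : asc v n 2 x * asc v n 1 y = lin v (y - x) 1 * asc v n 2 y * asc v n 1 x := by
    have hc := hv.commute_asc h0 one_pos x y
    calc asc v n 2 x * asc v n 1 y
        = lin v (-x) 1 * (asc v n 1 x * asc v n 1 y) := by
          rw [asc_eq h0 1 x]
          simp only [← mul_assoc, hv.lin_neg_mul_lin, one_mul]
      _ = lin v (y - x) 1 * asc v n 2 y * asc v n 1 x := by
          rw [hc.eq, asc_eq h0 1 y]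
          simp only [← mul_assoc, hv.lin_mul_lin]
          rw [sub_eq_neg_add]
  calc cFactor v n x * cFactor v n y
      = desc v n 1 x * lin v (2 * x) 0 * (asc v n 1 x * desc v n 1 y) * lin v (2 * y) 0 *
          asc v n 1 y := by
        rw [hv.cFactor_eq h0, hv.cFactor_eq h0]; simp only [mul_assoc]
    _ = desc v n 1 x * (lin v (2 * x) 0 * desc v n 2 y) * lin v y 1 * lin v x 1 *
          (asc v n 2 x * lin v (2 * y) 0) * asc v n 1 y := by
        rw [(hv.commute_asc_desc h0 one_pos x y).eq, desc_eq h0 1 y, asc_eq h0 1 x]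
        simp only [mul_assoc]
    _ = (desc v n 1 x * desc v n 2 y) * lin v (2 * x) 0 * (lin v y 1 * lin v x 1) *
          lin v (2 * y) 0 * (asc v n 2 x * asc v n 1 y) := by
        rw [(c01 _ _).eq, ← (c01' _ _).eq]; simp only [mul_assoc]
    _ = desc v n 1 y * desc v n 2 x * (lin v (x - y) 1 * lin v (2 * x) 0 * lin v (x + y) 1 *
          lin v (2 * y) 0) * (lin v (y - x) 1 * asc v n 2 y * asc v n 1 x) := by
        rw [e1, e2, hv.lin_mul_lin, add_comm y x]; simp only [mul_assoc]
    _ = desc v n 1 y * desc v n 2 x * lin v (2 * y) 0 * lin v (x + y) 1 * lin v (2 * x) 0 *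
          (lin v (x - y) 1 * lin v (-(x - y)) 1) * asc v n 2 y * asc v n 1 x := by
        rw [hv.yang_baxter_four, neg_sub]; simp only [mul_assoc]
    _ = desc v n 1 y * (desc v n 2 x * lin v (2 * y) 0) * lin v (x + y) 1 *
          (lin v (2 * x) 0 * asc v n 2 y) * asc v n 1 x := by
        rw [hv.lin_mul_lin_neg]; simp only [mul_assoc, one_mul]
    _ = desc v n 1 y * lin v (2 * y) 0 * (desc v n 2 x * lin v x 1) * (lin v y 1 * asc v n 2 y) *
          lin v (2 * x) 0 * asc v n 1 x := by
        rw [← (c01 _ _).eq, (c01' _ _).eq, ← hv.lin_mul_lin]; simp only [mul_assoc]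
    _ = desc v n 1 y * lin v (2 * y) 0 * (asc v n 1 y * desc v n 1 x) *
          lin v (2 * x) 0 * asc v n 1 x := by
        rw [(hv.commute_asc_desc h0 one_pos y x).eq, desc_eq h0 1 x, asc_eq h0 1 y]
        simp only [mul_assoc]
    _ = cFactor v n y * cFactor v n x := by
        rw [hv.cFactor_eq h0, hv.cFactor_eq h0]; simp only [mul_assoc]

end IsNilCoxeter
end generic

/-! ### Words and length -/

theorem prod_map_s_reverse (a : List ℕ) : (a.reverse.map s).prod = ((a.map s).prod)⁻¹ := by
  have h (i : ℕ) : (s i)⁻¹ = s i := inv_eq_of_mul_eq_one_left (s_mul_self i)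
  rw [List.prod_inv_reverse, List.map_map, List.map_reverse]
  simp [Function.comp_def, h]

theorem exists_isReducedWord {a : List ℕ} {w : SignedPerm} (h : (a.map s).prod = w) :
    ∃ b, IsReducedWord b w := by
  obtain ⟨b, hb, hw⟩ := Nat.sInf_mem
    (s := {k | ∃ a : List ℕ, a.length = k ∧ (a.map s).prod = w}) ⟨_, a, rfl, h⟩
  exact ⟨b, hw, hb⟩

theorem length_inv (w : SignedPerm) : length w⁻¹ = length w := by
  have h (v : SignedPerm) {k : ℕ} (hk : ∃ a : List ℕ, a.length = k ∧ (a.map s).prod = v) :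
      ∃ a : List ℕ, a.length = k ∧ (a.map s).prod = v⁻¹ := by
    obtain ⟨a, ha, hv⟩ := hk
    exact ⟨a.reverse, by simpa using ha, by rw [prod_map_s_reverse, hv]⟩
  unfold length
  congr 1
  ext k
  exact ⟨fun hk => by simpa using h _ hk, h w⟩

theorem length_one : length 1 = 0 := Nat.le_zero.1 (length_le (a := []) rfl)

theorem isReducedWord_nil (w : SignedPerm) : IsReducedWord [] w ↔ w = 1 := by
  constructor
  · rintro ⟨h, -⟩
    exact h.symm
  · rintro rfl
    exact ⟨rfl, length_one.symm⟩

theorem isReducedWord_reverse (a : List ℕ) (w : SignedPerm) :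
    IsReducedWord a.reverse w⁻¹ ↔ IsReducedWord a w := by
  rw [IsReducedWord, IsReducedWord, prod_map_s_reverse, length_inv, inv_inj, List.length_reverse]

theorem isReducedWord_append_singleton (a : List ℕ) (i : ℕ) (w : SignedPerm) :
    IsReducedWord (a ++ [i]) w ↔
      length (w * s i) < length w ∧ IsReducedWord a (w * s i) := by
  have h1 : ((a ++ [i]).map s).prod = w ↔ (a.map s).prod = w * s i := by
    rw [List.map_append, List.prod_append, List.map_singleton, List.prod_singleton,
      ← eq_mul_inv_iff_mul_eq, inv_eq_of_mul_eq_one_left (s_mul_self i)]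
  constructor
  · rintro ⟨h, hl⟩
    rw [List.length_append, List.length_singleton] at hl
    have ha := h1.1 h
    obtain ⟨b, hb, hbl⟩ := exists_isReducedWord ha
    have h2 := length_le ha
    have h3 : length w ≤ (b ++ [i]).length := length_le (by
      rw [List.map_append, List.prod_append, hb, List.map_singleton, List.prod_singleton,
        mul_assoc, s_mul_self, mul_one])
    rw [List.length_append, List.length_singleton] at h3
    exact ⟨by omega, ha, by omega⟩
  · rintro ⟨hlt, ha, hal⟩
    have h2 := length_le (h1.2 ha)
    refine ⟨h1.2 ha, ?_⟩
    rw [List.length_append, List.length_singleton] at h2 ⊢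
    omega

/-! ### Reduced words of the elements of `W_n` -/

/-- For `p ≥ 1`, the odd increasing bijection from `ℤ` onto the complement of `{p, -p}`. -/
def gap (p x : ℤ) : ℤ := if |x| < p then x else if 0 ≤ x then x + 1 else x - 1

theorem gap_injective (p : ℤ) : Function.Injective (gap p) := by
  intro x y h
  grind [gap]

/-- Deleting a strand from a word: if the strand that starts at position `p` takes part in the
crossing `s_i`, that letter disappears, and otherwise it is replaced by `s_i` or `s_{i-1}`. -/
theorem exists_s_gap (i : ℕ) {p : ℤ} (hp : 0 < p) :
    (((s i : Equiv.Perm ℤ) p = p ∧ (i : ℤ) + 1 ≠ p) ∧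
      ∃ j, ∀ x, (s i : Equiv.Perm ℤ) (gap p x) = gap p ((s j : Equiv.Perm ℤ) x)) ∨
    ∀ x, (s i : Equiv.Perm ℤ) (gap p x) = gap |(s i : Equiv.Perm ℤ) p| x := by
  cases i with
  | zero =>
    by_cases h1 : p = 1
    · right
      intro x
      simp only [s, sPerm_zero_apply, gap]
      grind
    · left
      simp only [s, sPerm_zero_apply]
      refine ⟨by grind, 0, fun x => ?_⟩
      simp only [sPerm_zero_apply, gap]
      grind
  | succ k =>
    by_cases h1 : p = k + 1 ∨ p = k + 2
    · right
      intro x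
      simp only [s, sPerm_succ_apply, gap]
      grind (splits := 40)
    · left
      simp only [s, sPerm_succ_apply]
      refine ⟨by push_cast; grind, ?_⟩
      rcases lt_or_ge p (k + 1) with h2 | h2
      · obtain ⟨k, rfl⟩ : ∃ l, k = l + 1 := ⟨k - 1, by omega⟩
        refine ⟨k + 1, fun x => ?_⟩
        simp only [sPerm_succ_apply, gap]
        push_cast at *
        grind (splits := 60)
      · refine ⟨k + 1, fun x => ?_⟩
        simp only [sPerm_succ_apply, gap]
        grind (splits := 60)

theorem signedPerm_abs (w : SignedPerm) (x : ℤ) :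
    (w : Equiv.Perm ℤ) |x| = (w : Equiv.Perm ℤ) x ∨
      (w : Equiv.Perm ℤ) |x| = -(w : Equiv.Perm ℤ) x := by
  rcases abs_choice x with h | h
  · exact .inl (by rw [h])
  · exact .inr (by rw [h, w.2.1])

/-- Deleting from a word the strand that starts at position `p`; the word gets shorter unless the
strand takes part in no crossing. -/
theorem exists_word_gap (a : List ℕ) {p : ℤ} (hp : 0 < p) :
    ∃ b : List ℕ, (∀ x, ((a.map s).prod : Equiv.Perm ℤ) (gap p x) =
        gap |((a.map s).prod : Equiv.Perm ℤ) p| (((b.map s).prod : Equiv.Perm ℤ) x)) ∧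
      (b.length < a.length ∨ b.length = a.length ∧ ((a.map s).prod : Equiv.Perm ℤ) p = p ∧
        ∀ i ∈ a, (i : ℤ) + 1 ≠ p) := by
  induction a with
  | nil => exact ⟨[], fun x => by simp [abs_of_pos hp], .inr (by simp)⟩
  | cons i a ih =>
    obtain ⟨b, hb, hl⟩ := ih
    set w := (a.map s).prod with hw
    set p' := |(w : Equiv.Perm ℤ) p| with hp'
    have hpos : 0 < p' := by
      rw [hp', abs_pos]
      intro h0
      have : (w : Equiv.Perm ℤ) 0 = 0 := by have := w.2.1 0; simp at this; omega
      exact hp.ne' ((w : Equiv.Perm ℤ).injective (h0.trans this.symm))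
    have hprod (c : List ℕ) (j : ℕ) (x : ℤ) : ((((j :: c).map s).prod : SignedPerm) :
        Equiv.Perm ℤ) x = (s j : Equiv.Perm ℤ) (((c.map s).prod : Equiv.Perm ℤ) x) := by
      simp
    have habs : |(s i : Equiv.Perm ℤ) p'| = |(s i : Equiv.Perm ℤ) ((w : Equiv.Perm ℤ) p)| := by
      rcases signedPerm_abs (s i) ((w : Equiv.Perm ℤ) p) with h | h <;> rw [hp', h]
      rw [abs_neg]
    simp only [hprod, ← hw, ← habs, hb]
    rcases exists_s_gap i hpos with ⟨⟨h1, h2⟩, j, hj⟩ | h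
    · refine ⟨j :: b, fun x => by rw [hj, h1, abs_of_pos hpos, hprod], ?_⟩
      rcases hl with hl | ⟨hl, hwp, hall⟩
      · exact .inl (by simpa using hl)
      · have hpp : p' = p := by rw [hp', hwp, abs_of_pos hp]
        rw [hpp] at h1 h2
        refine .inr ⟨by simpa using hl, by rw [hwp, h1], ?_⟩
        simpa using ⟨h2, hall⟩
    · exact ⟨b, fun x => by rw [h], .inl (by rw [List.length_cons]; omega)⟩

/-- A reduced word of an element of `W_n` only involves `s_0, …, s_{n-1}`. -/
theorem IsReducedWord.lt_of_mem {a : List ℕ} {w : SignedPerm} (ha : IsReducedWord a w) {n : ℕ}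
    (hw : w ∈ finiteW n) : ∀ i ∈ a, i < n := by
  by_contra! h
  obtain ⟨i, hi, hni⟩ := h
  -- Delete the strand `i + 1`, which `w` fixes: the result is a shorter word of `w`.
  have hp : (0 : ℤ) < i + 1 := by omega
  have hwp : (w : Equiv.Perm ℤ) (i + 1) = i + 1 := hw _ (by rw [abs_of_pos hp]; omega)
  obtain ⟨b, hb, hl⟩ := exists_word_gap a hp
  rw [ha.1, hwp, abs_of_pos hp] at hb
  have hgap (x : ℤ) : (w : Equiv.Perm ℤ) (gap (i + 1) x) = gap (i + 1) ((w : Equiv.Perm ℤ) x) := by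
    by_cases hx : |x| < i + 1
    · have : |(w : Equiv.Perm ℤ) x| < i + 1 := by
        by_contra hlt
        have h1 := hw ((w : Equiv.Perm ℤ) x) (by omega)
        have h2 := (w : Equiv.Perm ℤ).injective h1
        rw [h2] at hlt
        exact hlt hx
      rw [gap, gap, if_pos hx, if_pos this]
    · have h1 : (w : Equiv.Perm ℤ) x = x := hw x (by omega)
      have h2 : (n : ℤ) < |gap (i + 1) x| := by grind [gap]
      rw [hw _ h2, h1]
  have hbw : (b.map s).prod = w := by
    ext x
    exact gap_injective _ ((hb x).symm.trans (hgap x))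
  have h3 := length_le hbw
  have h4 := ha.2
  rcases hl with hl | ⟨-, -, hl⟩
  · omega
  · exact hl i hi rfl

theorem finiteW_mono {m n : ℕ} (h : m ≤ n) : finiteW m ⊆ finiteW n :=
  fun _ hw i hi => hw i (by omega)

theorem exists_mem_finiteW (w : SignedPerm) : ∃ n, w ∈ finiteW n := by
  obtain ⟨B, hB⟩ := (w.2.2.image fun i => |i|).bddAbove
  refine ⟨B.toNat, fun i hi => ?_⟩
  by_contra hne
  have := hB ⟨i, hne, rfl⟩
  simp only at this
  omega

theorem mem_finiteW_rank (w : SignedPerm) : w ∈ finiteW (rank w) :=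
  Nat.sInf_mem (exists_mem_finiteW w)

theorem s_mem_finiteW (i : ℕ) : s i ∈ finiteW (i + 1) := by
  intro x hx
  cases i with
  | zero => simp only [s, sPerm_zero_apply]; grind
  | succ k => simp only [s, sPerm_succ_apply]; grind

theorem mul_mem_finiteW {n : ℕ} {v w : SignedPerm} (hv : v ∈ finiteW n) (hw : w ∈ finiteW n) :
    v * w ∈ finiteW n := fun x hx => by
  rw [Subgroup.coe_mul, Equiv.Perm.mul_apply, hw x hx, hv x hx]

theorem inv_mem_finiteW {n : ℕ} {w : SignedPerm} (hw : w ∈ finiteW n) : w⁻¹ ∈ finiteW n :=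
  fun x hx => by rw [Subgroup.coe_inv, Equiv.Perm.inv_eq_iff_eq, hw x hx]

/-! ### The nilCoxeter algebra -/

section nilCoxeter

variable {R R' 𝒜 M : Type} [CommRing R] [CommRing R'] [Ring 𝒜] [Algebra R' 𝒜] {n : ℕ}

/-- The generators of the nilCoxeter algebra of `W_n`, extended by zero to a sequence. -/
def uExt (R : Type) [CommRing R] (n i : ℕ) : NilCoxeter R n :=
  if h : i < n then u R (⟨i, h⟩ : Fin n) else 0

theorem uExt_val (i : Fin n) : uExt R n i = u R i := by simp [uExt]

theorem uExt_of_le {i : ℕ} (h : n ≤ i) : uExt R n i = 0 := by simp [uExt, h.not_gt]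

theorem mk_eq_of_rel {x y : FreeAlgebra R (Fin n)} (h : NilCoxeterRel R n x y) :
    ((x : FreeAlgebra R (Fin n)) : (ringConGen (NilCoxeterRel R n)).Quotient) = y :=
  (RingCon.eq _).2 (RingConGen.Rel.of _ _ h)

theorem isNilCoxeter_uExt (R : Type) [CommRing R] (n : ℕ) : IsNilCoxeter (uExt R n) where
  sq i := by
    by_cases h : i < n
    · simpa [uExt, h, u] using mk_eq_of_rel (NilCoxeterRel.sq (R := R) (⟨i, h⟩ : Fin n))
    · simp [uExt, h]
  comm {i j} hij := by
    by_cases h : j < n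
    · have h' : i < n := by omega
      simpa [uExt, h, h', u] using
        mk_eq_of_rel (NilCoxeterRel.comm (R := R) (⟨i, h'⟩ : Fin n) ⟨j, h⟩ hij)
    · simp [uExt, h]
  braid i hi := by
    by_cases h : i + 1 < n
    · have h' : i < n := by omega
      simpa [uExt, h, h', u] using
        mk_eq_of_rel (NilCoxeterRel.braid (R := R) (⟨i, h'⟩ : Fin n) ⟨i + 1, h⟩ hi rfl)
    · simp [uExt, h]
  four := by
    by_cases h : 1 < n
    · have h' : 0 < n := by omega
      simpa [uExt, h, h', u] using
        mk_eq_of_rel (NilCoxeterRel.four (R := R) (⟨0, h'⟩ : Fin n) ⟨1, h⟩ rfl rfl)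
    · simp [uExt, h]

/-- The universal property of the nilCoxeter algebra, for homomorphisms that are semilinear over a
change of the ring of coefficients. -/
def nilLift (n : ℕ) (φ : R →+* R') {v : ℕ → 𝒜} (hv : IsNilCoxeter v) : NilCoxeter R n →+* 𝒜 :=
  letI : Algebra R 𝒜 := Algebra.compHom 𝒜 φ
  (ringConGen (NilCoxeterRel R n)).lift
    (FreeAlgebra.lift R fun i : Fin n => v i : FreeAlgebra R (Fin n) →ₐ[R] 𝒜).toRingHom (by
      rw [RingCon.ringConGen_le]
      intro x y h
      change (FreeAlgebra.lift R fun i : Fin n => v i : FreeAlgebra R (Fin n) →ₐ[R] 𝒜) x =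
        (FreeAlgebra.lift R fun i : Fin n => v i : FreeAlgebra R (Fin n) →ₐ[R] 𝒜) y
      cases h with
      | sq i => simpa using hv.sq i
      | comm i j h => simpa using hv.comm h
      | braid i j hi h => simpa [h] using hv.braid i hi
      | four i j hi hj => simpa [hi, hj] using hv.four)

variable (φ : R →+* R') {v : ℕ → 𝒜} (hv : IsNilCoxeter v)

theorem nilLift_u (i : Fin n) : nilLift n φ hv (u R i) = v i := by
  let _ : Algebra R 𝒜 := Algebra.compHom 𝒜 φ
  change (FreeAlgebra.lift R fun i : Fin n => v i : FreeAlgebra R (Fin n) →ₐ[R] 𝒜) _ = _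
  simp

theorem nilLift_uExt (i : ℕ) (h : n ≤ i → v i = 0) : nilLift n φ hv (uExt R n i) = v i := by
  by_cases hi : i < n
  · rw [uExt, dif_pos hi, nilLift_u]
  · rw [uExt, dif_neg hi, map_zero, h (by omega)]

theorem nilLift_smul (r : R) (x : NilCoxeter R n) :
    nilLift n φ hv (r • x) = φ r • nilLift n φ hv x := by
  let _ : Algebra R 𝒜 := Algebra.compHom 𝒜 φ
  obtain ⟨x, rfl⟩ := (ringConGen (NilCoxeterRel R n)).mk'_surjective x
  change (FreeAlgebra.lift R fun i : Fin n => v i : FreeAlgebra R (Fin n) →ₐ[R] 𝒜) (r • x) =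
    φ r • (FreeAlgebra.lift R fun i : Fin n => v i : FreeAlgebra R (Fin n) →ₐ[R] 𝒜) x
  rw [map_smul]
  rfl

/-- The nilCoxeter algebra is spanned by the words in the generators. -/
theorem nilCoxeter_induction {P : NilCoxeter R n → Prop} (hadd : ∀ x y, P x → P y → P (x + y))
    (hword : ∀ (r : R) (a : List (Fin n)), P (r • (a.map (u R)).prod)) (x : NilCoxeter R n) :
    P x := by
  obtain ⟨x, rfl⟩ := (ringConGen (NilCoxeterRel R n)).mk'_surjective x
  have hx : x ∈ Submodule.span R (Set.range (FreeAlgebra.basisFreeMonoid R (Fin n))) := by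
    rw [Module.Basis.span_eq]; trivial
  have hw (r : R) (a : FreeMonoid (Fin n)) :
      (ringConGen (NilCoxeterRel R n)).mk' (r • FreeAlgebra.basisFreeMonoid R (Fin n) a) =
        r • (a.toList.map (u R)).prod := by
    have h1 : (ringConGen (NilCoxeterRel R n)).mk' (r • FreeAlgebra.basisFreeMonoid R (Fin n) a) =
        r • (ringConGen (NilCoxeterRel R n)).mk' (FreeAlgebra.basisFreeMonoid R (Fin n) a) := rfl
    rw [h1, basisFreeMonoid_eq, FreeMonoid.lift_apply, map_list_prod, List.map_map]
    rfl
  induction hx using Submodule.closure_induction with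
  | zero =>
    have h := hword 0 []
    rw [map_zero]
    rwa [show (0 : R) • (([] : List (Fin n)).map (u R)).prod = 0 from
      zero_smul R (([] : List (Fin n)).map (u R)).prod] at h
  | add x y _ _ hx hy => rw [map_add]; exact hadd _ _ hx hy
  | smul_mem r x hx =>
    obtain ⟨a, rfl⟩ := hx
    rw [hw]
    exact hword r a.toList

open Classical in
theorem coeff_smul_word (w : SignedPerm) (r : R) (a : List (Fin n)) :
    coeff w (r • (a.map (u R)).prod) = if IsReducedWord (a.map Fin.val) w then r else 0 := by
  rw [map_smul, coeff_word]
  simp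

open Classical in
theorem coeff_one (w : SignedPerm) : coeff w (1 : NilCoxeter R n) = if w = 1 then 1 else 0 := by
  have := coeff_word (R := R) (n := n) w []
  simpa [isReducedWord_nil] using this

/-- The coefficient of `u_w` in `x u_i` is that of `u_{w s_i}` in `x` if `w s_i` is shorter than
`w`. -/
theorem coeff_mul_u (w : SignedPerm) (x : NilCoxeter R n) (i : Fin n) :
    coeff w (x * u R i) = if length (w * s i) < length w then coeff (w * s i) x else 0 := by
  classical
  induction x using nilCoxeter_induction with
  | hadd x y hx hy =>
    rw [add_mul, map_add, hx, hy, map_add]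
    split_ifs <;> simp
  | hword r a =>
    have h : r • (a.map (u R)).prod * u R i = r • ((a ++ [i]).map (u R)).prod := by
      rw [List.map_append, List.prod_append, List.map_singleton, List.prod_singleton]
      exact Algebra.smul_mul_assoc r _ _
    rw [h, coeff_smul_word, coeff_smul_word, List.map_append, List.map_singleton,
      isReducedWord_append_singleton]
    split_ifs <;> simp_all

theorem nilLift_word (r : R) (a : List (Fin n)) : nilLift n φ hv (r • (a.map (u R)).prod) =
    φ r • (a.map fun i : Fin n => v i).prod := by
  rw [nilLift_smul, map_list_prod, List.map_map]
  congr 3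
  ext i
  exact nilLift_u φ hv i

theorem exists_fin_word (a : List ℕ) (ha : ∀ i ∈ a, i < n) :
    ∃ b : List (Fin n), b.map Fin.val = a := by
  induction a with
  | nil => exact ⟨[], rfl⟩
  | cons i a ih =>
    rw [List.forall_mem_cons] at ha
    obtain ⟨b, rfl⟩ := ih ha.2
    exact ⟨⟨i, ha.1⟩ :: b, rfl⟩

/-- Functoriality in the rank and in the coefficients: the homomorphism that maps `u_i` to `u_i` or,
if `i` is out of range, to `0`. -/
def nilMap (m n : ℕ) (φ : R →+* R') : NilCoxeter R m →+* NilCoxeter R' n :=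
  nilLift m φ (isNilCoxeter_uExt R' n)

/-- Setting `u_n, u_{n+1}, …` to zero preserves the coefficients of `u_w` for `w ∈ W_n`, because these
generators occur in no reduced word of `w`. -/
theorem coeff_nilMap {m : ℕ} {w : SignedPerm} (hw : w ∈ finiteW n) (x : NilCoxeter R m) :
    coeff w (nilMap m n φ x) = φ (coeff w x) := by
  classical
  induction x using nilCoxeter_induction with
  | hadd x y hx hy => simp only [map_add, hx, hy]
  | hword r a =>
    rw [nilMap, nilLift_word, coeff_smul_word, map_smul]
    by_cases ha : ∀ i ∈ a.map Fin.val, i < n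
    · obtain ⟨b, hb⟩ := exists_fin_word _ ha
      have h1 : (a.map fun i : Fin m => uExt R' n i) = b.map (u R') := by
        rw [show (fun i : Fin m => uExt R' n i) = uExt R' n ∘ Fin.val from rfl, ← List.map_map,
          ← hb, List.map_map]
        exact List.map_congr_left fun i _ => uExt_val i
      rw [h1, coeff_word, hb]
      split_ifs <;> simp
    · have h1 : (a.map fun i : Fin m => uExt R' n i).prod = 0 := by
        push Not at ha
        obtain ⟨_, hj, hni⟩ := ha
        obtain ⟨i, hi, rfl⟩ := List.mem_map.1 hj
        exact List.prod_eq_zero (List.mem_map.2 ⟨i, hi, uExt_of_le hni⟩)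
      rw [h1, if_neg]
      · simp
      · intro h
        exact ha fun i hi => h.lt_of_mem hw i hi

theorem isNilCoxeter_op (R : Type) [CommRing R] (n : ℕ) :
    IsNilCoxeter fun i => MulOpposite.op (uExt R n i) where
  sq i := by rw [← MulOpposite.op_mul, (isNilCoxeter_uExt R n).sq, MulOpposite.op_zero]
  comm h := by rw [← MulOpposite.op_mul, ← MulOpposite.op_mul, (isNilCoxeter_uExt R n).comm h]
  braid i h := by
    simp only [← MulOpposite.op_mul]
    rw [← mul_assoc, (isNilCoxeter_uExt R n).braid i h, mul_assoc]
  four := by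
    simp only [← MulOpposite.op_mul]
    rw [← mul_assoc, ← mul_assoc, ← (isNilCoxeter_uExt R n).four, mul_assoc, mul_assoc]

/-- The anti-homomorphism of nilCoxeter algebras that reverses words. -/
def nilReverse (n : ℕ) (φ : R →+* R') : NilCoxeter R n →+* (NilCoxeter R' n)ᵐᵒᵖ :=
  nilLift n φ (isNilCoxeter_op R' n)

/-- A word is a reduced word of `w` if and only if its reverse is a reduced word of `w⁻¹`. -/
theorem coeff_nilReverse (w : SignedPerm) (x : NilCoxeter R n) :
    coeff w⁻¹ (nilReverse n φ x).unop = φ (coeff w x) := by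
  classical
  induction x using nilCoxeter_induction with
  | hadd x y hx hy => simp only [map_add, MulOpposite.unop_add, hx, hy]
  | hword r a =>
    have : (a.map fun i : Fin n => MulOpposite.op (uExt R' n i)).prod.unop =
        (a.reverse.map (u R')).prod := by
      rw [MulOpposite.unop_list_prod, List.map_map, List.map_reverse]
      congr 3
      ext i
      exact uExt_val i
    rw [nilReverse, nilLift_word, coeff_smul_word, MulOpposite.unop_smul, this, coeff_smul_word,
      List.map_reverse, isReducedWord_reverse]
    split_ifs <;> simp

end nilCoxeter

/-! ### The product of the three families of factors -/

section generic

variable {R R' 𝒜 𝒜' : Type*} [CommRing R] [CommRing R'] [Ring 𝒜] [Ring 𝒜'] [Algebra R 𝒜]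
  [Algebra R' 𝒜'] {v : ℕ → 𝒜} {n : ℕ}

/-- `A_1(y_1) A_2(y_2) ⋯ A_K(y_K)`. -/
def yPart (v : ℕ → 𝒜) (n K : ℕ) (y : ℕ → R) : 𝒜 :=
  ((List.range K).map fun j => desc v n (j + 1) (y j)).prod

/-- `Ã_K(z_K) ⋯ Ã_2(z_2) Ã_1(z_1)`. -/
def zPart (v : ℕ → 𝒜) (n K : ℕ) (z : ℕ → R) : 𝒜 :=
  ((List.range K).reverse.map fun j => asc v n (j + 1) (-z j)).prod

/-- `C(x_1) ⋯ C(x_N)`. -/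
def xPart (v : ℕ → 𝒜) (n N : ℕ) (x : ℕ → R) : 𝒜 :=
  ((List.range N).map fun j => cFactor v n (x j)).prod

/-- The product whose coefficients are the double Schubert polynomials, for arbitrary generators
and arbitrary values of the variables. -/
def fullProduct (v : ℕ → 𝒜) (n N : ℕ) (x y z : ℕ → R) : 𝒜 :=
  zPart v n (n - 1) z * xPart v n N x * yPart v n (n - 1) y

theorem desc_cutoff (h0 : ∀ j, n ≤ j → v j = 0) {m : ℕ} (h : n ≤ m) (i : ℕ) (t : R) :
    desc v m i t = desc v n i t := by
  induction i using downward_induction m with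
  | hb i hi => rw [desc_of_le hi, desc_of_le (h.trans hi)]
  | hs i ih =>
    rw [desc_eq h0, desc_eq fun j hj => h0 j (h.trans hj), ih _ (Nat.lt_succ_self i)]

theorem asc_cutoff (h0 : ∀ j, n ≤ j → v j = 0) {m : ℕ} (h : n ≤ m) (i : ℕ) (t : R) :
    asc v m i t = asc v n i t := by
  induction i using downward_induction m with
  | hb i hi => rw [asc_of_le hi, asc_of_le (h.trans hi)]
  | hs i ih =>
    rw [asc_eq h0, asc_eq fun j hj => h0 j (h.trans hj), ih _ (Nat.lt_succ_self i)]

theorem fullProduct_cutoff (h0 : ∀ j, n ≤ j → v j = 0) {m : ℕ} (h : n ≤ m) (N : ℕ)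
    (x y z : ℕ → R) : fullProduct v m N x y z = fullProduct v n N x y z := by
  obtain ⟨r, hr⟩ : ∃ r, m - 1 = n - 1 + r := ⟨m - 1 - (n - 1), by omega⟩
  have h1 : yPart v n (n - 1 + r) y = yPart v n (n - 1) y := by
    rw [yPart, List.range_add, List.map_append, List.prod_append, ← yPart,
      List.prod_eq_one (l := List.map _ (List.map _ _)), mul_one]
    intro a ha
    simp only [List.map_map, List.mem_map, Function.comp_apply] at ha
    obtain ⟨k, -, rfl⟩ := ha
    exact desc_of_le (by omega) _
  have h2 : zPart v n (n - 1 + r) z = zPart v n (n - 1) z := by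
    rw [zPart, List.range_add, List.reverse_append, List.map_append, List.prod_append, ← zPart,
      List.prod_eq_one, one_mul]
    intro a ha
    simp only [List.mem_map, List.mem_reverse] at ha
    obtain ⟨_, ⟨k, -, rfl⟩, rfl⟩ := ha
    exact asc_of_le (by omega) _
  rw [fullProduct, fullProduct, hr, ← h1, ← h2]
  simp only [yPart, zPart, xPart, cFactor, desc_cutoff h0 h, asc_cutoff h0 h]

section map

variable {φ : R →+* R'} {Φ : 𝒜 →+* 𝒜'} (hΦ : ∀ (r : R) (a : 𝒜), Φ (r • a) = φ r • Φ a)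
include hΦ

theorem map_desc (n i : ℕ) (t : R) : Φ (desc v n i t) = desc (fun j => Φ (v j)) n i (φ t) := by
  rw [desc, map_list_prod, List.map_map]
  simp [desc, lin, Function.comp_def, hΦ]
  rfl

theorem map_asc (n i : ℕ) (t : R) : Φ (asc v n i t) = asc (fun j => Φ (v j)) n i (φ t) := by
  rw [asc, map_list_prod, List.map_map]
  simp [asc, lin, Function.comp_def, hΦ]
  rfl

theorem map_yPart (n K : ℕ) (y : ℕ → R) :
    Φ (yPart v n K y) = yPart (fun j => Φ (v j)) n K fun j => φ (y j) := by
  rw [yPart, map_list_prod, List.map_map]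
  simp only [yPart, Function.comp_def, map_desc hΦ]

theorem map_zPart (n K : ℕ) (z : ℕ → R) :
    Φ (zPart v n K z) = zPart (fun j => Φ (v j)) n K fun j => φ (z j) := by
  rw [zPart, map_list_prod, List.map_map]
  simp only [zPart, Function.comp_def, map_asc hΦ, map_neg]

theorem map_xPart (n N : ℕ) (x : ℕ → R) :
    Φ (xPart v n N x) = xPart (fun j => Φ (v j)) n N fun j => φ (x j) := by
  rw [xPart, map_list_prod, List.map_map]
  simp only [xPart, cFactor, Function.comp_def, map_asc hΦ, map_desc hΦ, map_mul]

theorem map_fullProduct (n N : ℕ) (x y z : ℕ → R) : Φ (fullProduct v n N x y z) =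
    fullProduct (fun j => Φ (v j)) n N (fun j => φ (x j)) (fun j => φ (y j)) fun j => φ (z j) := by
  simp only [fullProduct, map_mul, map_yPart hΦ, map_zPart hΦ, map_xPart hΦ]

end map

theorem desc_op (n i : ℕ) (t : R) :
    desc (fun j => MulOpposite.op (v j)) n i t = MulOpposite.op (asc v n i t) := by
  rw [asc, MulOpposite.op_list_prod, List.map_map, desc, ← List.map_reverse]
  rfl

theorem asc_op (n i : ℕ) (t : R) :
    asc (fun j => MulOpposite.op (v j)) n i t = MulOpposite.op (desc v n i t) := by
  rw [desc, MulOpposite.op_list_prod, List.map_map, ← List.map_reverse, List.reverse_reverse, asc]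
  rfl

namespace IsNilCoxeter

variable (hv : IsNilCoxeter v) (h0 : ∀ j, n ≤ j → v j = 0)
include hv h0

/-- Reversing the product interchanges the roles of `y_j` and `-z_j`. -/
theorem fullProduct_op (N : ℕ) (x y z : ℕ → R) :
    fullProduct (fun j => MulOpposite.op (v j)) n N x y z =
      MulOpposite.op (fullProduct v n N x (fun j => -z j) fun j => -y j) := by
  have hx : xPart (fun j => MulOpposite.op (v j)) n N x = MulOpposite.op (xPart v n N x) := by
    rw [xPart, xPart, MulOpposite.op_list_prod, List.map_map, ← List.map_reverse]
    have hc : (fun j => cFactor (fun j => MulOpposite.op (v j)) n (x j)) =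
        MulOpposite.op ∘ fun j => cFactor v n (x j) := by
      ext1 j
      simp only [cFactor, desc_op, asc_op, Function.comp_apply, MulOpposite.op_mul]
    rw [hc]
    refine List.Perm.prod_eq' ((List.reverse_perm _).symm.map _) ?_
    rw [List.pairwise_map]
    refine List.pairwise_of_forall fun i j => ?_
    exact (hv.commute_cFactor h0 (x i) (x j)).op
  have hy : yPart (fun j => MulOpposite.op (v j)) n (n - 1) y =
      MulOpposite.op (zPart v n (n - 1) fun j => -y j) := by
    rw [yPart, zPart, MulOpposite.op_list_prod, List.map_map, ← List.map_reverse,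
      List.reverse_reverse]
    simp only [desc_op, Function.comp_def, neg_neg]
  have hz : zPart (fun j => MulOpposite.op (v j)) n (n - 1) z =
      MulOpposite.op (yPart v n (n - 1) fun j => -z j) := by
    rw [yPart, zPart, MulOpposite.op_list_prod, List.map_map, ← List.map_reverse]
    simp only [asc_op, Function.comp_def]
  rw [fullProduct, fullProduct, hx, hy, hz]
  simp only [MulOpposite.op_mul, mul_assoc]

theorem yPart_swap_sub {k : ℕ} (K : ℕ) (y : ℕ → R) :
    yPart v n (k + 2 + K) y - yPart v n (k + 2 + K) (fun j => y (Equiv.swap k (k + 1) j)) =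
      (y k - y (k + 1)) • (yPart v n (k + 2 + K) y * v (k + 1)) := by
  have split (y : ℕ → R) : yPart v n (k + 2 + K) y = yPart v n k y *
      (desc v n (k + 1) (y k) * desc v n (k + 2) (y (k + 1))) *
        ((List.range K).map fun j => desc v n (k + 2 + j + 1) (y (k + 2 + j))).prod := by
    simp [yPart, List.range_add, List.range_succ, mul_assoc, Function.comp_def]
  have h1 : yPart v n k (fun j => y (Equiv.swap k (k + 1) j)) = yPart v n k y := by
    unfold yPart
    congr 1
    refine List.map_congr_left fun j hj => ?_
    have := List.mem_range.1 hj
    simp only [Equiv.swap_apply_of_ne_of_ne (show j ≠ k by omega) (show j ≠ k + 1 by omega)]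
  have h2 (j : ℕ) : Equiv.swap k (k + 1) (k + 2 + j) = k + 2 + j :=
    Equiv.swap_apply_of_ne_of_ne (by omega) (by omega)
  have h3 : Commute (v (k + 1))
      ((List.range K).map fun j => desc v n (k + 2 + j + 1) (y (k + 2 + j))).prod := by
    refine Commute.list_prod_right _ _ fun a ha => ?_
    obtain ⟨j, -, rfl⟩ := List.mem_map.1 ha
    exact hv.commute_v_desc (by omega) _
  rw [split, split, h1]
  simp only [h2, Equiv.swap_apply_left, Equiv.swap_apply_right]
  rw [← sub_mul, ← mul_sub, hv.desc_mul_desc_sub h0 (Nat.succ_pos k)]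
  simp only [mul_smul_comm, smul_mul_assoc, mul_assoc]
  rw [h3.eq]

/-- The effect on the product of the divided difference `∂_i^y`, for `i ≥ 1`. -/
theorem fullProduct_swap_sub {k : ℕ} (hk : k + 3 ≤ n) (N : ℕ) (x y z : ℕ → R) :
    fullProduct v n N x y z - fullProduct v n N x (fun j => y (Equiv.swap k (k + 1) j)) z =
      (y k - y (k + 1)) • (fullProduct v n N x y z * v (k + 1)) := by
  obtain ⟨K, hK⟩ : ∃ K, n - 1 = k + 2 + K := ⟨n - 1 - (k + 2), by omega⟩
  rw [fullProduct, fullProduct, ← mul_sub, hK, hv.yPart_swap_sub h0, mul_smul_comm, mul_assoc,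
    mul_assoc]
  simp only [mul_assoc]

/-- The effect on the product of the divided difference `∂_0^y`. Since the factors `C` commute, the
factor `C(y_1)` that `s_0` adds can be moved next to `A_1(-y_1)`. -/
theorem fullProduct_zero_sub (hn : 2 ≤ n) (N : ℕ) (x y z x' y' : ℕ → R) (hx0 : x' 0 = y 0)
    (hx : ∀ j, x' (j + 1) = x j) (hy0 : y' 0 = -y 0) (hy : ∀ j, y' (j + 1) = y (j + 1)) :
    fullProduct v n N x y z - fullProduct v n (N + 1) x' y' z =
      (-2 * y 0) • (fullProduct v n N x y z * v 0) := by
  obtain ⟨K, hK⟩ : ∃ K, n - 1 = K + 1 := ⟨n - 2, by omega⟩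
  have split (y : ℕ → R) : yPart v n (K + 1) y = desc v n 1 (y 0) *
      ((List.range K).map fun j => desc v n (j + 2) (y (j + 1))).prod := by
    simp [yPart, List.range_succ_eq_map, Function.comp_def]
  have hX : xPart v n (N + 1) x' = xPart v n N x * cFactor v n (y 0) := by
    have : xPart v n (N + 1) x' = cFactor v n (y 0) * xPart v n N x := by
      simp [xPart, List.range_succ_eq_map, Function.comp_def, hx, hx0]
    rw [this]
    refine Commute.list_prod_right _ _ fun a ha => ?_
    obtain ⟨j, -, rfl⟩ := List.mem_map.1 ha
    exact hv.commute_cFactor h0 _ _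
  have h3 : Commute (v 0)
      ((List.range K).map fun j => desc v n (j + 2) (y (j + 1))).prod := by
    refine Commute.list_prod_right _ _ fun a ha => ?_
    obtain ⟨j, -, rfl⟩ := List.mem_map.1 ha
    exact hv.commute_v_desc (by omega) _
  set T := ((List.range K).map fun j => desc v n (j + 2) (y (j + 1))).prod with hT
  have e : fullProduct v n (N + 1) x' y' z =
      zPart v n (n - 1) z * xPart v n N x * (desc v n 1 (y 0) * lin v (2 * y 0) 0 * T) := by
    rw [fullProduct, hX, hK, split, hy0, ← hv.cFactor_mul_desc_neg h0]
    simp only [hy, ← hT, mul_assoc]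
  rw [e, fullProduct, hK, split, ← hT, mul_assoc _ _ (v 0), mul_assoc _ T, ← h3.eq, lin]
  simp only [mul_add, add_mul, mul_one, mul_smul_comm, smul_mul_assoc, mul_assoc]
  module

end IsNilCoxeter
end generic

theorem filter_finRange_map_val (n i : ℕ) :
    ((List.finRange n).filter fun j : Fin n => i ≤ (j : ℕ)).map Fin.val =
      List.range' i (n - i) := by
  have h1 : ((List.finRange n).filter fun j : Fin n => i ≤ (j : ℕ)).map Fin.val =
      (List.range n).filter fun j => i ≤ j := by
    rw [← List.map_coe_finRange_eq_range, List.filter_map]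
    rfl
  rw [h1]
  clear h1
  induction n with
  | zero => simp
  | succ n ih =>
    rw [List.range_succ, List.filter_append, ih]
    by_cases h : i ≤ n
    · have h2 : n + 1 - i = n - i + 1 := by omega
      rw [h2, List.range'_1_concat]
      simp [h]
    · have h2 : n + 1 - i = 0 := by omega
      have h3 : n - i = 0 := by omega
      simp [h, h2, h3]

theorem lin_uExt {R : Type} [CommRing R] {n : ℕ} (t : R) (j : Fin n) :
    lin (uExt R n) t j = 1 + t • u R j := by
  rw [lin, uExt_val]

theorem A_eq_desc (n i : ℕ) (t : Poly) : A n i t = desc (uExt Poly n) n i t := by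
  rw [A, desc, ← filter_finRange_map_val, ← List.map_reverse, List.map_map]
  have h : (fun j : Fin n => 1 + t • u Poly j) = lin (uExt Poly n) t ∘ Fin.val := by
    ext1 j
    exact (lin_uExt t j).symm
  rw [h]

theorem ATilde_eq_asc (n i : ℕ) (t : Poly) : ATilde n i t = asc (uExt Poly n) n i (-t) := by
  rw [ATilde, asc, ← filter_finRange_map_val, List.map_map]
  congr 2
  ext1 j
  refine Eq.trans ?_ (lin_uExt (-t) j).symm
  rw [sub_eq_add_neg]
  congr 1
  exact (neg_smul t (u Poly j)).symm

theorem cFactor_eq_CFactor (n : ℕ) (t : Poly) : CFactor n t = cFactor (uExt Poly n) n t := by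
  have h := filter_finRange_map_val n 0
  simp only [Nat.zero_le, decide_true, List.filter_true] at h
  rw [cFactor, desc, asc, ← h, ← List.map_reverse, List.map_map, List.map_map, CFactor]
  have h2 : (fun j : Fin n => 1 + t • u Poly j) = lin (uExt Poly n) t ∘ Fin.val := by
    ext1 j
    exact (lin_uExt t j).symm
  rw [h2]

/-- The variables `x_1, x_2, …`, as polynomials. -/
def xPoly (j : ℕ) : Poly := MvPolynomial.X (Var.x j)

/-- The variables `y_1, y_2, …`, as polynomials. -/
def yPoly (j : ℕ) : Poly := MvPolynomial.X (Var.y j)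

/-- The variables `z_1, z_2, …`, as polynomials. -/
def zPoly (j : ℕ) : Poly := MvPolynomial.X (Var.z j)

theorem schubertProduct_eq (n N : ℕ) :
    schubertProduct n N = fullProduct (uExt Poly n) n N xPoly yPoly zPoly := by
  simp only [schubertProduct, fullProduct, zPart, xPart, yPart, A_eq_desc, ATilde_eq_asc,
    cFactor_eq_CFactor, xPoly, yPoly, zPoly]

/-! ### A product over the `x_i` as a polynomial in the `q_r(X)` -/

section splitting

/-- Over an extension ring, a monic polynomial is a product of linear factors. -/
theorem exists_splitting (d : ℕ) : ∀ (B : Type) [CommRing B] [Nontrivial B] (f : Polynomial B),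
    f.Monic → f.natDegree = d → ∃ (B' : Type) (_ : CommRing B') (ι : B →+* B'),
      Function.Injective ι ∧ ∃ a : Fin d → B',
        f.map ι = ∏ j, (Polynomial.X + Polynomial.C (a j)) := by
  induction d with
  | zero =>
    intro B _ _ f hf hd
    refine ⟨B, inferInstance, RingHom.id B, Function.injective_id, Fin.elim0, ?_⟩
    simp [Polynomial.eq_one_of_monic_natDegree_zero hf hd]
  | succ d ih =>
    intro B _ _ f hf hd
    have hinj : Function.Injective (AdjoinRoot.of f) := by
      rw [injective_iff_map_eq_zero]
      intro b hb
      by_contra hb0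
      rw [← AdjoinRoot.mk_C, AdjoinRoot.mk_eq_zero] at hb
      exact hf.not_dvd_of_natDegree_lt (by simpa using hb0) (by simp [hd]) hb
    have : Nontrivial (AdjoinRoot f) := hinj.nontrivial
    set F := f.map (AdjoinRoot.of f) with hF
    have hr : F.IsRoot (AdjoinRoot.root f) := AdjoinRoot.isRoot_root f
    have hfac := Polynomial.mul_divByMonic_eq_iff_isRoot.2 hr
    have hFm : F.Monic := hf.map _
    have hm : (F /ₘ (Polynomial.X - Polynomial.C (AdjoinRoot.root f))).Monic :=
      (Polynomial.monic_X_sub_C _).of_mul_monic_left (by rw [hfac]; exact hFm)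
    have hdeg : (F /ₘ (Polynomial.X - Polynomial.C (AdjoinRoot.root f))).natDegree = d := by
      rw [Polynomial.natDegree_divByMonic _ (Polynomial.monic_X_sub_C _),
        Polynomial.natDegree_X_sub_C, hf.natDegree_map, hd, Nat.add_sub_cancel]
    obtain ⟨B', inst, ι, hι, a, ha⟩ := ih _ _ hm hdeg
    refine ⟨B', inst, ι.comp (AdjoinRoot.of f), hι.comp hinj,
      Fin.cons (-ι (AdjoinRoot.root f)) a, ?_⟩
    rw [← Polynomial.map_map, ← hF, ← hfac, Polynomial.map_mul, ha, Fin.prod_univ_succ]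
    simp [sub_eq_add_neg]

end splitting

section nilpotent

variable {B : Type} [CommRing B] [Algebra Poly B]

/-- The value of a power series at an element `a` with `a ^ (D + 1) = 0`. -/
def nilEval (D : ℕ) (a : B) (f : PowerSeries Poly) : B :=
  Polynomial.aeval a (PowerSeries.trunc (D + 1) f)

variable {D : ℕ} {a : B}

theorem aeval_trunc_coe (ha : a ^ (D + 1) = 0) (p : Polynomial Poly) :
    nilEval D a (p : PowerSeries Poly) = Polynomial.aeval a p := by
  induction p using Polynomial.induction_on' with
  | add p q hp hq =>
    rw [map_add, ← hp, ← hq, nilEval, Polynomial.coe_add, map_add, map_add]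
    rfl
  | monomial k c =>
    rw [nilEval, Polynomial.coe_monomial]
    by_cases hk : k < D + 1
    · congr 1
      ext1 j
      rw [PowerSeries.coeff_trunc, PowerSeries.coeff_monomial, Polynomial.coeff_monomial]
      split_ifs <;> first | rfl | omega
    · have h0 : PowerSeries.trunc (D + 1) (PowerSeries.monomial k c) = 0 := by
        ext1 j
        rw [PowerSeries.coeff_trunc, PowerSeries.coeff_monomial, Polynomial.coeff_zero]
        split_ifs <;> first | rfl | omega
      rw [h0, map_zero, Polynomial.aeval_monomial,
        pow_eq_zero_of_le (not_lt.1 hk) ha, mul_zero]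

theorem nilEval_mul (ha : a ^ (D + 1) = 0) (f g : PowerSeries Poly) :
    nilEval D a (f * g) = nilEval D a f * nilEval D a g := by
  rw [nilEval, ← PowerSeries.trunc_trunc_mul_trunc, ← Polynomial.coe_mul]
  exact (aeval_trunc_coe ha _).trans (map_mul _ _ _)

/-- The generating function `(1 + x t) / (1 - x t)` at `t = a`. -/
theorem nilEval_qFactor (ha : a ^ (D + 1) = 0) (x : Poly) :
    nilEval D a (qFactor x) * (1 - x • a) = 1 + x • a := by
  have h1 : (1 - x • a : B) = nilEval D a (1 - PowerSeries.C x * PowerSeries.X) := by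
    have := aeval_trunc_coe ha (1 - Polynomial.C x * Polynomial.X)
    simp only [Polynomial.coe_sub, Polynomial.coe_one, Polynomial.coe_mul, Polynomial.coe_C,
      Polynomial.coe_X] at this
    rw [this]
    simp [Algebra.smul_def]
  have h2 : (1 + x • a : B) = nilEval D a (1 + PowerSeries.C x * PowerSeries.X) := by
    have := aeval_trunc_coe ha (1 + Polynomial.C x * Polynomial.X)
    simp only [Polynomial.coe_add, Polynomial.coe_one, Polynomial.coe_mul, Polynomial.coe_C,
      Polynomial.coe_X] at this
    rw [this]
    simp [Algebra.smul_def]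
  have h3 : (PowerSeries.mk fun k => x ^ k) * (1 - PowerSeries.C x * PowerSeries.X) = 1 := by
    ext1 k
    rw [mul_sub, mul_one, ← mul_assoc, mul_comm _ (PowerSeries.C x), mul_assoc, map_sub,
      PowerSeries.coeff_C_mul]
    cases k with
    | zero => simp
    | succ k => rw [PowerSeries.coeff_succ_mul_X]; simp [PowerSeries.coeff_one, pow_succ']
  rw [h1, h2, ← nilEval_mul ha, qFactor, mul_assoc, h3, mul_one]

theorem nilEval_prod_qFactor (ha : a ^ (D + 1) = 0) (x : ℕ → Poly) (N : ℕ) :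
    nilEval D a (∏ i ∈ Finset.range N, qFactor (x i)) * ∏ i ∈ Finset.range N, (1 - x i • a) =
      ∏ i ∈ Finset.range N, (1 + x i • a) := by
  induction N with
  | zero =>
    have := aeval_trunc_coe ha 1
    rw [Polynomial.coe_one, map_one] at this
    simp [this]
  | succ N ih =>
    rw [Finset.prod_range_succ, Finset.prod_range_succ, Finset.prod_range_succ, nilEval_mul ha,
      ← ih, ← nilEval_qFactor ha (x N)]
    ring

end nilpotent

/-- The homomorphism from the polynomial ring in symbols `q_0, q_1, …` that maps `q_r` to
`q_r(x_1, …, x_N)`. -/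
def qEval (N : ℕ) : MvPolynomial ℕ ℤ →+* Poly :=
  (MvPolynomial.aeval fun r => qPoly r N : MvPolynomial ℕ ℤ →ₐ[ℤ] Poly)

/-- The elementary symmetric functions as the coefficients of `∏ (1 + a_j t)`. -/
theorem prod_one_add_smul {B : Type} [CommRing B] [Algebra Poly B] {M : ℕ} (a : Fin M → B)
    (t : Poly) : ∏ j, (1 + t • a j) =
      ∑ k ∈ Finset.range (M + 1), t ^ k • (Finset.univ.val.map a).esymm k := by
  rw [Finset.prod_one_add, Finset.sum_powerset, Finset.card_univ, Fintype.card_fin]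
  refine Finset.sum_congr rfl fun k _ => ?_
  rw [Finset.esymm_map_val, Finset.smul_sum]
  refine Finset.sum_congr rfl fun S hS => ?_
  rw [Finset.prod_smul, Finset.prod_const, (Finset.mem_powersetCard.1 hS).2]

/-- Let `E(t) = ∑ e_k t ^ k` have constant coefficient `1` and nilpotent higher coefficients. Then
the product of the `E(x_i) / E(-x_i)` is a polynomial in the `e_k` with coefficients in
`ℤ[q_1, q_2, …]`, the same for all numbers of variables. Indeed, if `E(t) = ∏ (1 + a_j t)`, then the
product equals `∏_j ∑_r q_r a_j ^ r`, which is symmetric in the `a_j`. -/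
theorem exists_prod_eq_eval {B : Type} [CommRing B] [Algebra Poly B] (M : ℕ) (e : ℕ → B)
    (he0 : e 0 = 1) (hnil : ∀ k, 0 < k → IsNilpotent (e k)) (c : ℕ → B)
    (hc : ∀ i, c i * ∑ k ∈ Finset.range (M + 1), (-xPoly i) ^ k • e k =
      ∑ k ∈ Finset.range (M + 1), xPoly i ^ k • e k) :
    ∃ G : MvPolynomial (Fin M) (MvPolynomial ℕ ℤ), ∀ N, ∏ i ∈ Finset.range N, c i =
      MvPolynomial.eval₂Hom ((algebraMap Poly B).comp (qEval N)) (fun j : Fin M => e (j + 1)) G := by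
  cases subsingleton_or_nontrivial B with
  | inl h => exact ⟨0, fun N => Subsingleton.elim _ _⟩
  | inr h =>
  -- The polynomial `X ^ M E(1 / X)`.
  set f : Polynomial B := ∑ k ∈ Finset.range (M + 1), Polynomial.C (e (M - k)) * Polynomial.X ^ k
    with hf
  have hcoeff (k : ℕ) (hk : k ≤ M) : f.coeff k = e (M - k) := by
    simp [hf, Polynomial.coeff_X_pow, hk]
  have hle : f.natDegree ≤ M := Polynomial.natDegree_sum_le_of_forall_le _ _ fun k hk =>
    (Polynomial.natDegree_C_mul_X_pow_le _ _).trans (by simpa [Nat.lt_succ_iff] using hk)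
  have h1 : f.coeff M = 1 := by rw [hcoeff M le_rfl, Nat.sub_self, he0]
  have hmonic : f.Monic := Polynomial.monic_of_natDegree_le_of_coeff_eq_one M hle h1
  have hdeg : f.natDegree = M := le_antisymm hle (Polynomial.le_natDegree_of_ne_zero (by simp [h1]))
  obtain ⟨B', _, ι, hι, a, ha⟩ := exists_splitting M B f hmonic hdeg
  let _ : Algebra Poly B' := (ι.comp (algebraMap Poly B)).toAlgebra
  have hιsmul (r : Poly) (b : B) : ι (r • b) = r • ι b := by
    rw [Algebra.smul_def, map_mul, Algebra.smul_def]; rfl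
  have hesymm (k : ℕ) (hk : k ≤ M) : (Finset.univ.val.map a).esymm k = ι (e k) := by
    have hcard : Multiset.card (Finset.univ.val.map a) = M := by simp
    have := Multiset.prod_X_add_C_coeff (Finset.univ.val.map a) (k := M - k) (by rw [hcard]; omega)
    rw [hcard, Nat.sub_sub_self hk, Multiset.map_map] at this
    rw [← this]
    have h2 : ((Finset.univ.val.map ((fun r => Polynomial.X + Polynomial.C r) ∘ a))).prod =
        f.map ι := ha.symm
    rw [h2, Polynomial.coeff_map, hcoeff _ (Nat.sub_le _ _), Nat.sub_sub_self hk]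
  have hE (t : Poly) : ι (∑ k ∈ Finset.range (M + 1), t ^ k • e k) = ∏ j, (1 + t • a j) := by
    rw [prod_one_add_smul, map_sum]
    refine Finset.sum_congr rfl fun k hk => ?_
    rw [hιsmul, hesymm k (Nat.lt_succ_iff.1 (Finset.mem_range.1 hk))]
  have hanil (j : Fin M) : IsNilpotent (a j) := by
    have h0 : (f.map ι).eval (-a j) = 0 := by
      rw [ha, Polynomial.eval_prod]
      exact Finset.prod_eq_zero (Finset.mem_univ j) (by simp)
    rw [hf, Polynomial.map_sum, Polynomial.eval_finsetSum, Finset.sum_range_succ] at h0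
    simp only [Polynomial.map_mul, Polynomial.map_C, Polynomial.map_pow, Polynomial.map_X,
      Polynomial.eval_mul, Polynomial.eval_C, Polynomial.eval_pow, Polynomial.eval_X, Nat.sub_self,
      he0, map_one, one_mul] at h0
    have h3 : IsNilpotent ((-a j) ^ M) := by
      rw [eq_neg_of_add_eq_zero_right h0, isNilpotent_neg_iff]
      refine isNilpotent_sum fun k hk => ?_
      have hk' := Finset.mem_range.1 hk
      exact (Commute.all _ _).isNilpotent_mul_right ((hnil (M - k) (by omega)).map ι)
    obtain ⟨m, hm⟩ := h3
    rw [← isNilpotent_neg_iff]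
    exact ⟨M * m, by rw [pow_mul, hm]⟩
  choose d hd using hanil
  obtain ⟨D, hD⟩ : ∃ D, ∀ j, a j ^ (D + 1) = 0 := ⟨∑ j, d j, fun j =>
    pow_eq_zero_of_le ((Finset.single_le_sum (f := d) (fun _ _ => Nat.zero_le _)
      (Finset.mem_univ j)).trans (Nat.le_succ _)) (hd j)⟩
  -- The symmetric polynomial `∏_j ∑_{r ≤ D} q_r a_j ^ r`.
  set p : MvPolynomial (Fin M) (MvPolynomial ℕ ℤ) := ∏ j, ∑ r ∈ Finset.range (D + 1),
    MvPolynomial.C (MvPolynomial.X r) * MvPolynomial.X j ^ r with hp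
  have hsymm : p.IsSymmetric := by
    intro σ
    simp only [hp, map_prod, map_sum, map_mul, MvPolynomial.rename_C, map_pow,
      MvPolynomial.rename_X]
    exact Equiv.prod_comp σ fun j => ∑ r ∈ Finset.range (D + 1),
      MvPolynomial.C (MvPolynomial.X r) * (MvPolynomial.X j : MvPolynomial (Fin M) _) ^ r
  obtain ⟨G, hG⟩ : ∃ G : MvPolynomial (Fin M) (MvPolynomial ℕ ℤ), MvPolynomial.aeval
      (fun i : Fin M => MvPolynomial.esymm (Fin M) (MvPolynomial ℕ ℤ) (i + 1)) G = p := by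
    obtain ⟨G, hG⟩ := (MvPolynomial.esymmAlgEquiv (Fin M) (MvPolynomial ℕ ℤ)
      (Fintype.card_fin M)).surjective ⟨p, hsymm⟩
    refine ⟨G, ?_⟩
    have := congrArg Subtype.val hG
    rwa [MvPolynomial.esymmAlgEquiv_apply, MvPolynomial.esymmAlgHom_apply] at this
  refine ⟨G, fun N => hι ?_⟩
  have hιG : ι (MvPolynomial.eval₂Hom ((algebraMap Poly B).comp (qEval N))
      (fun j : Fin M => e (j + 1)) G) =
      ∏ j, nilEval D (a j) (∏ i ∈ Finset.range N, qFactor (xPoly i)) := by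
    have h2 := MvPolynomial.map_aeval
      (fun i : Fin M => MvPolynomial.esymm (Fin M) (MvPolynomial ℕ ℤ) (i + 1))
      (MvPolynomial.eval₂Hom ((algebraMap Poly B').comp (qEval N)) a) G
    rw [hG] at h2
    have h3 (i : Fin M) : MvPolynomial.eval₂Hom ((algebraMap Poly B').comp (qEval N)) a
        (MvPolynomial.esymm (Fin M) (MvPolynomial ℕ ℤ) (i + 1)) = ι (e (i + 1)) := by
      rw [← hesymm _ i.2, Finset.esymm_map_val, MvPolynomial.esymm, map_sum]
      simp
    have h4 : (MvPolynomial.eval₂Hom ((algebraMap Poly B').comp (qEval N)) a).comp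
        (algebraMap (MvPolynomial ℕ ℤ) (MvPolynomial (Fin M) (MvPolynomial ℕ ℤ))) =
        ι.comp ((algebraMap Poly B).comp (qEval N)) := by
      ext r
      · simp
      · simp [RingHom.algebraMap_toAlgebra]
    rw [h4] at h2
    simp only [h3] at h2
    rw [MvPolynomial.coe_eval₂Hom, MvPolynomial.eval₂_comp_left]
    refine Eq.trans h2.symm ?_
    rw [hp, map_prod]
    refine Finset.prod_congr rfl fun j _ => ?_
    rw [nilEval, PowerSeries.trunc_apply, map_sum, map_sum, Nat.Ico_zero_eq_range]
    refine Finset.sum_congr rfl fun r _ => ?_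
    simp only [map_mul, map_pow, MvPolynomial.eval₂Hom_C, MvPolynomial.eval₂Hom_X',
      Polynomial.aeval_monomial, RingHom.comp_apply, qEval]
    simp [qPoly, xPoly]
  have hunit : IsUnit (∏ j, ∏ i ∈ Finset.range N, (1 - xPoly i • a j)) := by
    refine IsUnit.prod_univ_iff.2 fun j => IsUnit.prod_iff.2 fun i _ => ?_
    exact IsNilpotent.isUnit_one_sub ⟨D + 1, by rw [smul_pow, hD, smul_zero]⟩
  refine hunit.mul_right_cancel ?_
  rw [hιG, ← Finset.prod_mul_distrib]
  simp only [nilEval_prod_qFactor (hD _) xPoly N]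
  rw [Finset.prod_comm, map_prod, Finset.prod_comm (s := Finset.univ), ← Finset.prod_mul_distrib]
  refine Finset.prod_congr rfl fun i _ => ?_
  rw [← hE, ← hc i, map_mul, hE]
  simp only [neg_smul, sub_eq_add_neg]

/-! ### The coefficients of `(C(t) + 1) / 2` -/

section ePoly

variable {𝒜 𝒜' : Type*} [Ring 𝒜] [Ring 𝒜']

/-- The polynomial `E(t) = (C(t) + 1) / 2`. The recursion replaces the division by `2`: since
`h_n(t) ^ 2 = 1 + 2 t v_n`, the equality `C = 2 E - 1` passes from `n` to `n + 1`. -/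
def ePoly (v : ℕ → 𝒜) : ℕ → Polynomial 𝒜
  | 0 => 1
  | n + 1 => (1 + Polynomial.C (v n) * Polynomial.X) * ePoly v n *
      (1 + Polynomial.C (v n) * Polynomial.X) - Polynomial.C (v n) * Polynomial.X

theorem map_ePoly (Φ : 𝒜 →+* 𝒜') (v : ℕ → 𝒜) (n : ℕ) :
    (ePoly v n).map Φ = ePoly (fun j => Φ (v j)) n := by
  induction n with
  | zero => simp [ePoly]
  | succ n ih => simp [ePoly, ih]

theorem coeff_zero_ePoly (v : ℕ → 𝒜) (n : ℕ) : (ePoly v n).coeff 0 = 1 := by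
  induction n with
  | zero => simp [ePoly]
  | succ n ih => simp [ePoly, Polynomial.mul_coeff_zero, ih]

theorem ePoly_zero (n : ℕ) : ePoly (fun _ => (0 : 𝒜)) n = 1 := by
  induction n with
  | zero => rfl
  | succ n ih => simp [ePoly, ih]

variable {R : Type*} [CommRing R] [Algebra R 𝒜]

/-- Evaluation of polynomials with coefficients in `𝒜` at a scalar. -/
def scalarEval (t : R) : Polynomial 𝒜 →+* 𝒜 :=
  Polynomial.eval₂RingHom' (RingHom.id 𝒜) (algebraMap R 𝒜 t) fun a =>
    (Algebra.commutes t a).symm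

theorem scalarEval_eq_sum (t : R) {p : Polynomial 𝒜} {m : ℕ} (h : p.natDegree < m) :
    scalarEval t p = ∑ k ∈ Finset.range m, t ^ k • p.coeff k := by
  rw [scalarEval]
  change p.eval₂ (RingHom.id 𝒜) (algebraMap R 𝒜 t) = _
  rw [Polynomial.eval₂_eq_sum_range' _ h]
  refine Finset.sum_congr rfl fun k _ => ?_
  rw [RingHom.id_apply, ← map_pow, Algebra.smul_def, Algebra.commutes]

theorem scalarEval_linear (t : R) (a : 𝒜) :
    scalarEval t (Polynomial.C a * Polynomial.X) = t • a := by
  rw [scalarEval]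
  change (Polynomial.C a * Polynomial.X).eval₂ (RingHom.id 𝒜) (algebraMap R 𝒜 t) = _
  rw [Polynomial.eval₂_mul_X, Polynomial.eval₂_C, RingHom.id_apply, Algebra.smul_def,
    Algebra.commutes]

theorem IsNilCoxeter.cFactor_eq_ePoly {v : ℕ → 𝒜} (hv : IsNilCoxeter v) (n : ℕ) (t : R) :
    cFactor v n t = 2 * scalarEval t (ePoly v n) - 1 := by
  induction n with
  | zero => simp [cFactor, desc, asc, ePoly]; norm_num
  | succ n ih =>
    have h1 : cFactor v (n + 1) t = lin v t n * cFactor v n t * lin v t n := by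
      simp [cFactor, desc, asc, List.range'_1_concat, mul_assoc]
    have h2 : lin v t n * lin v t n = 1 + 2 * (t • v n) := by
      rw [hv.lin_mul_lin, lin, add_smul, two_mul]
    rw [h1, ih, ePoly, map_sub, map_mul, map_mul, map_add, map_one, scalarEval_linear, ← lin]
    calc lin v t n * (2 * scalarEval t (ePoly v n) - 1) * lin v t n
        = 2 * (lin v t n * scalarEval t (ePoly v n) * lin v t n) - lin v t n * lin v t n := by
          noncomm_ring
      _ = 2 * (lin v t n * scalarEval t (ePoly v n) * lin v t n - t • v n) - 1 := by
          rw [h2]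
          noncomm_ring

end ePoly

/-! ### A quotient of the nilCoxeter algebra -/

section wordFiltration

variable {R : Type} [CommRing R] {n : ℕ}

/-- The span of the words of length at least `k`. -/
def wordFiltration (R : Type) [CommRing R] (n k : ℕ) : Submodule R (NilCoxeter R n) :=
  Submodule.span R {x | ∃ a : List (Fin n), k ≤ a.length ∧ x = (a.map (u R)).prod}

theorem mem_wordFiltration_zero (x : NilCoxeter R n) : x ∈ wordFiltration R n 0 := by
  induction x using nilCoxeter_induction with
  | hadd x y hx hy => exact Submodule.add_mem _ hx hy
  | hword r a => exact Submodule.smul_mem _ r (Submodule.subset_span ⟨a, Nat.zero_le _, rfl⟩)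

theorem mul_mem_wordFiltration {j k : ℕ} {x y : NilCoxeter R n} (hx : x ∈ wordFiltration R n j)
    (hy : y ∈ wordFiltration R n k) : x * y ∈ wordFiltration R n (j + k) := by
  have h := Submodule.mul_mem_mul hx hy
  rw [wordFiltration, wordFiltration, Submodule.span_mul_span] at h
  refine Submodule.span_mono ?_ h
  rintro _ ⟨_, ⟨a, ha, rfl⟩, _, ⟨b, hb, rfl⟩, rfl⟩
  exact ⟨a ++ b, by rw [List.length_append]; omega, by simp⟩

theorem pow_mem_wordFiltration {x : NilCoxeter R n} (hx : x ∈ wordFiltration R n 1) (k : ℕ) :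
    x ^ k ∈ wordFiltration R n k := by
  induction k with
  | zero => exact mem_wordFiltration_zero _
  | succ k ih => rw [pow_succ]; exact mul_mem_wordFiltration ih hx

theorem coeff_eq_zero_of_mem_wordFiltration {w : SignedPerm} {k : ℕ} (h : length w < k)
    {x : NilCoxeter R n} (hx : x ∈ wordFiltration R n k) : coeff w x = 0 := by
  classical
  have : wordFiltration R n k ≤ LinearMap.ker (coeff w) := by
    refine Submodule.span_le.2 ?_
    rintro _ ⟨a, ha, rfl⟩
    rw [SetLike.mem_coe, LinearMap.mem_ker, coeff_word, if_neg]
    rintro ⟨-, hl⟩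
    rw [List.length_map] at hl
    omega
  exact this hx

theorem isNilCoxeter_zero : IsNilCoxeter fun _ => (0 : R) where
  sq _ := by simp
  comm _ := by simp
  braid _ _ := by simp
  four := by simp

/-- The augmentation, which maps all `u_i` to `0`. -/
def augmentation (R : Type) [CommRing R] (n : ℕ) : NilCoxeter R n →+* R :=
  nilLift n (RingHom.id R) isNilCoxeter_zero

theorem sub_augmentation_mem (x : NilCoxeter R n) :
    x - augmentation R n x • 1 ∈ wordFiltration R n 1 := by
  induction x using nilCoxeter_induction with
  | hadd x y hx hy =>
    have h := Submodule.add_mem _ hx hy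
    rw [map_add]
    convert h using 1
    rw [sub_add_sub_comm]
    congr 1
    exact add_smul (augmentation R n x) (augmentation R n y) (1 : NilCoxeter R n)
  | hword r a =>
    rw [augmentation, nilLift_word]
    cases a with
    | nil => simp
    | cons i a =>
      simp only [List.map_cons, List.prod_cons, zero_mul, smul_zero]
      refine Submodule.sub_mem _ (Submodule.smul_mem _ r (Submodule.subset_span
        ⟨i :: a, by simp, by simp⟩)) ?_
      convert Submodule.zero_mem _
      exact zero_smul R (1 : NilCoxeter R n)

end wordFiltration

section coeffQuotient

variable {R : Type} [CommRing R] {n : ℕ}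

/-- The congruence on the nilCoxeter algebra of having, in every context, the same coefficient of
`u_w`. -/
def coeffConAt (R : Type) [CommRing R] (n : ℕ) (w : SignedPerm) : RingCon (NilCoxeter R n) where
  r x y := ∀ p q : NilCoxeter R n, coeff w (p * x * q) = coeff w (p * y * q)
  iseqv := ⟨fun _ _ _ => rfl, fun h p q => (h p q).symm, fun h h' p q => (h p q).trans (h' p q)⟩
  mul' := fun {x y x' y'} h h' p q => by
    have e₁ := h p (x' * q)
    have e₂ := h' (p * y) q
    simp only [mul_assoc] at e₁ e₂ ⊢
    exact e₁.trans e₂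
  add' := fun {x y x' y'} h h' p q => by
    simp only [mul_add, add_mul, map_add, h p q, h' p q]

/-- The quotient of the nilCoxeter algebra in which an element vanishes if it does not contribute to
the coefficient of `u_w` of any of its multiples. Unlike for the nilCoxeter algebra itself, it is
plain that the quotient has no torsion, and that its augmentation ideal is nilpotent. -/
def CoeffQuotient (R : Type) [CommRing R] (n : ℕ) (w : SignedPerm) : Type :=
  (coeffConAt R n w).Quotient

instance (w : SignedPerm) : Ring (CoeffQuotient R n w) :=
  inferInstanceAs (Ring (coeffConAt R n w).Quotient)

instance (w : SignedPerm) : Algebra R (CoeffQuotient R n w) :=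
  inferInstanceAs (Algebra R (coeffConAt R n w).Quotient)

/-- The map from the nilCoxeter algebra onto its quotient `CoeffQuotient`. -/
def toQuotient (R : Type) [CommRing R] (n : ℕ) (w : SignedPerm) :
    NilCoxeter R n →ₐ[R] CoeffQuotient R n w :=
  (coeffConAt R n w).mkₐ R

variable {w : SignedPerm}

theorem toQuotient_eq_iff {x y : NilCoxeter R n} : toQuotient R n w x = toQuotient R n w y ↔
    ∀ p q : NilCoxeter R n, coeff w (p * x * q) = coeff w (p * y * q) :=
  RingCon.eq _

theorem toQuotient_eq_zero_iff {x : NilCoxeter R n} : toQuotient R n w x = 0 ↔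
    ∀ p q : NilCoxeter R n, coeff w (p * x * q) = 0 := by
  rw [← map_zero (toQuotient R n w), toQuotient_eq_iff]
  simp

theorem toQuotient_surjective : Function.Surjective (toQuotient R n w) :=
  (coeffConAt R n w).mkₐ_surjective

/-- The powers of `x` are combinations of longer and longer words, and a word that is longer than `w`
does not contribute to the coefficient of `u_w`. -/
theorem isNilpotent_toQuotient {x : NilCoxeter R n} (hx : augmentation R n x = 0) :
    IsNilpotent (toQuotient R n w x) := by
  have h1 : x ∈ wordFiltration R n 1 := by
    have := sub_augmentation_mem x
    rw [hx] at this
    convert this using 1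
    refine Eq.trans (sub_zero x).symm ?_
    congr 1
    exact (zero_smul R (1 : NilCoxeter R n)).symm
  refine ⟨length w + 1, ?_⟩
  rw [← map_pow, toQuotient_eq_zero_iff]
  intro p q
  have := mul_mem_wordFiltration (mul_mem_wordFiltration (mem_wordFiltration_zero p)
    (pow_mem_wordFiltration h1 (length w + 1))) (mem_wordFiltration_zero q)
  exact coeff_eq_zero_of_mem_wordFiltration (by omega) this

theorem two_mul_cancel (w : SignedPerm) {x y : CoeffQuotient Poly n w} (h : 2 * x = 2 * y) :
    x = y := by
  obtain ⟨x, rfl⟩ := toQuotient_surjective x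
  obtain ⟨y, rfl⟩ := toQuotient_surjective y
  rw [← map_ofNat (toQuotient Poly n w) 2, ← map_mul, ← map_mul, toQuotient_eq_iff] at h
  rw [toQuotient_eq_iff]
  intro p q
  have := h p q
  simp only [two_mul, mul_add, add_mul, map_add] at this
  rw [← two_mul, ← two_mul] at this
  exact mul_left_cancel₀ two_ne_zero this

/-- A polynomial function of a scalar that vanishes identically has zero coefficients. -/
theorem eq_zero_of_forall_sum_eq_zero {m : ℕ} (f : ℕ → CoeffQuotient Poly n w)
    (h : ∀ t : Poly, ∑ k ∈ Finset.range m, t ^ k • f k = 0) : ∀ k < m, f k = 0 := by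
  intro k hk
  choose g hg using fun k => toQuotient_surjective (f k)
  rw [← hg k, toQuotient_eq_zero_iff]
  intro p q
  have h1 : (∑ k ∈ Finset.range m, Polynomial.C (coeff w (p * g k * q)) * Polynomial.X ^ k :
      Polynomial Poly) = 0 := by
    refine Polynomial.funext fun t => ?_
    have h2 : toQuotient Poly n w (∑ k ∈ Finset.range m, t ^ k • g k) = 0 := by
      rw [← h t, map_sum]
      exact Finset.sum_congr rfl fun k _ => by rw [map_smul, hg]
    have h3 := toQuotient_eq_zero_iff.1 h2 p q
    rw [Finset.mul_sum, Finset.sum_mul, map_sum] at h3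
    rw [Polynomial.eval_finsetSum, Polynomial.eval_zero, ← h3]
    refine Finset.sum_congr rfl fun k _ => ?_
    have h4 : p * t ^ k • g k * q = t ^ k • (p * g k * q) :=
      (congrArg (· * q) (Algebra.mul_smul_comm (t ^ k) p (g k))).trans
        (Algebra.smul_mul_assoc (t ^ k) (p * g k) q)
    rw [h4, map_smul, smul_eq_mul, Polynomial.eval_mul, Polynomial.eval_C, Polynomial.eval_pow,
      Polynomial.eval_X, mul_comm]
  have h5 := congrArg (fun r => Polynomial.coeff r k) h1
  simpa [Polynomial.coeff_X_pow, hk] using h5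

end coeffQuotient

/-! ### Limits in the variables `X` -/

/-- The power series `f` is the limit of the polynomials `p N`: the coefficients of `f` and `p N`
agree at all monomials that involve none of `x_{N+1}, x_{N+2}, …`. -/
def IsXLimit (p : ℕ → Poly) (f : Series) : Prop :=
  ∀ (m : Var →₀ ℕ) (N : ℕ), xBound m ≤ N → MvPowerSeries.coeff m f = MvPolynomial.coeff m (p N)

namespace IsXLimit

variable {p r : ℕ → Poly} {f g : Series}

theorem eq_xLimit (h : IsXLimit p f) : xLimit p = f := by
  ext m
  exact (h m _ le_rfl).symm

theorem unique (hf : IsXLimit p f) (hg : IsXLimit p g) : f = g :=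
  hf.eq_xLimit.symm.trans hg.eq_xLimit

theorem const (c : Poly) : IsXLimit (fun _ => c) c := fun m _ _ => MvPolynomial.coeff_coe c m

theorem add (hf : IsXLimit p f) (hg : IsXLimit r g) : IsXLimit (p + r) (f + g) := by
  intro m N h
  rw [map_add, hf m N h, hg m N h, Pi.add_apply, MvPolynomial.coeff_add]

theorem sub (hf : IsXLimit p f) (hg : IsXLimit r g) : IsXLimit (p - r) (f - g) := by
  intro m N h
  rw [map_sub, hf m N h, hg m N h, Pi.sub_apply, MvPolynomial.coeff_sub]

theorem mul (hf : IsXLimit p f) (hg : IsXLimit r g) : IsXLimit (p * r) (f * g) := by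
  classical
  intro m N h
  rw [MvPowerSeries.coeff_mul, Pi.mul_apply, MvPolynomial.coeff_mul]
  refine Finset.sum_congr rfl fun d hd => ?_
  have hd' := Finset.HasAntidiagonal.mem_antidiagonal.1 hd
  rw [hf d.1 N ((xBound_mono (le_iff_exists_add.2 ⟨d.2, hd'.symm⟩)).trans h),
    hg d.2 N ((xBound_mono (le_iff_exists_add'.2 ⟨d.1, hd'.symm⟩)).trans h)]

theorem shift (hf : IsXLimit p f) : IsXLimit (fun N => p (N + 1)) f :=
  fun m N h => hf m (N + 1) (h.trans (Nat.le_succ N))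

theorem aeval_coe (a : Var → Poly) (P : Poly) :
    MvPolynomial.aeval (fun v => (a v : Series)) P = (MvPolynomial.aeval a P : Poly) := by
  induction P using MvPolynomial.induction_on with
  | C c =>
    rw [← MvPolynomial.algebraMap_eq, AlgHom.commutes, AlgHom.commutes,
      MvPolynomial.algebraMap_eq, MvPolynomial.coe_C]
    rfl
  | add p q hp hq => simp only [map_add, hp, hq, MvPolynomial.coe_add]
  | mul_X p v hp => simp only [map_mul, hp, MvPolynomial.aeval_X, MvPolynomial.coe_mul]

/-- A tame substitution commutes with limits, up to the loss of one variable. -/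
theorem subst (hf : IsXLimit p f) {a : Var → Poly} (ha : IsTame a) :
    IsXLimit (fun N => MvPolynomial.aeval a (p (N + 1)))
      (MvPowerSeries.substAlgHom ha.hasSubst f) := by
  intro m N h
  rw [ha.coeff_subst (g := (p (N + 1) : Series)) fun d hd => by
      rw [MvPolynomial.coeff_coe]; exact hf d (N + 1) (by omega),
    MvPowerSeries.substAlgHom_coe, aeval_coe, MvPolynomial.coeff_coe]

end IsXLimit

/-- The sequences of polynomials that have a limit in `Γ[Y,Z]`. -/
def limitSubalgebra : Subalgebra ℤ (ℕ → Poly) where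
  carrier := {p | ∃ f ∈ GammaYZ, IsXLimit p f}
  mul_mem' := by
    rintro p r ⟨f, hf, hpf⟩ ⟨g, hg, hrg⟩
    exact ⟨f * g, mul_mem hf hg, hpf.mul hrg⟩
  add_mem' := by
    rintro p r ⟨f, hf, hpf⟩ ⟨g, hg, hrg⟩
    exact ⟨f + g, add_mem hf hg, hpf.add hrg⟩
  algebraMap_mem' c := by
    refine ⟨algebraMap ℤ Series c, algebraMap_mem _ c, ?_⟩
    have := IsXLimit.const (MvPolynomial.C c)
    rw [MvPolynomial.coe_C] at this
    exact this

theorem isXLimit_q (r : ℕ) : IsXLimit (qPoly r) (q r) := fun _ _ h => coeff_q r h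

/-- The polynomial ring `ℤ[Y,Z]`. -/
def polyYZ : Subalgebra ℤ Poly := Algebra.adjoin ℤ (Set.range yPoly ∪ Set.range zPoly)

theorem const_mem_limitSubalgebra {c : Poly} (hc : c ∈ polyYZ) :
    (fun _ => c) ∈ limitSubalgebra := by
  have h : polyYZ ≤ limitSubalgebra.comap (Pi.constAlgHom ℤ ℕ Poly) := by
    refine Algebra.adjoin_le ?_
    rintro _ (⟨j, rfl⟩ | ⟨j, rfl⟩)
    · refine ⟨MvPowerSeries.X (Var.y j), y_mem j, ?_⟩
      rw [← coe_X_var]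
      exact IsXLimit.const _
    · refine ⟨MvPowerSeries.X (Var.z j), z_mem j, ?_⟩
      rw [← coe_X_var]
      exact IsXLimit.const _
  exact h hc

theorem qEval_mem_limitSubalgebra (g : MvPolynomial ℕ ℤ) :
    (fun N => qEval N g) ∈ limitSubalgebra := by
  have h : (fun N => qEval N g) = MvPolynomial.aeval (fun r N => qPoly r N) g := by
    ext1 N
    have := MvPolynomial.map_aeval (fun r N => qPoly r N) (Pi.evalRingHom (fun _ : ℕ => Poly) N) g
    refine Eq.trans ?_ this.symm
    rw [qEval]
    exact MvPolynomial.aeval_def _ _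
  rw [h]
  clear h
  induction g using MvPolynomial.induction_on with
  | C c => rw [MvPolynomial.aeval_C]; exact algebraMap_mem _ c
  | add g h hg hh => rw [map_add]; exact add_mem hg hh
  | mul_X g r hg =>
    rw [map_mul, MvPolynomial.aeval_X]
    exact mul_mem hg ⟨q r, q_mem r, isXLimit_q r⟩

/-! ### The coefficients belong to `Γ[Y,Z]` -/

section membership

variable {n : ℕ} {w : SignedPerm}

theorem toQuotient_cFactor (t : Poly) : toQuotient Poly n w (cFactor (uExt Poly n) n t) =
    2 * toQuotient Poly n w (scalarEval t (ePoly (uExt Poly n) n)) - 1 := by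
  rw [(isNilCoxeter_uExt Poly n).cFactor_eq_ePoly, map_sub, map_mul, map_ofNat, map_one]

theorem commute_toQuotient_scalarEval (s t : Poly) :
    Commute (toQuotient Poly n w (scalarEval s (ePoly (uExt Poly n) n)))
      (toQuotient Poly n w (scalarEval t (ePoly (uExt Poly n) n))) := by
  have h := ((isNilCoxeter_uExt Poly n).commute_cFactor (fun j hj => uExt_of_le hj) s t).map
    (toQuotient Poly n w)
  rw [toQuotient_cFactor, toQuotient_cFactor] at h
  have h' := h.eq
  generalize toQuotient Poly n w (scalarEval s (ePoly (uExt Poly n) n)) = a at *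
  generalize toQuotient Poly n w (scalarEval t (ePoly (uExt Poly n) n)) = b at *
  refine two_mul_cancel w (two_mul_cancel w ?_)
  have e1 : 2 * (2 * (a * b)) = (2 * a - 1) * (2 * b - 1) + 2 * a + 2 * b - 1 := by noncomm_ring
  have e2 : 2 * (2 * (b * a)) = (2 * b - 1) * (2 * a - 1) + 2 * a + 2 * b - 1 := by noncomm_ring
  rw [e1, e2, h']

/-- `C(t) E(-t) = E(t)`, because `C(t) C(-t) = 1`. -/
theorem toQuotient_cFactor_mul (t : Poly) : toQuotient Poly n w (cFactor (uExt Poly n) n t) *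
    toQuotient Poly n w (scalarEval (-t) (ePoly (uExt Poly n) n)) =
      toQuotient Poly n w (scalarEval t (ePoly (uExt Poly n) n)) := by
  have h := congrArg (toQuotient Poly n w)
    ((isNilCoxeter_uExt Poly n).cFactor_mul_neg (fun j hj => uExt_of_le hj) t)
  rw [map_mul, map_one, toQuotient_cFactor, toQuotient_cFactor] at h
  rw [toQuotient_cFactor]
  generalize toQuotient Poly n w (scalarEval t (ePoly (uExt Poly n) n)) = a at *
  generalize toQuotient Poly n w (scalarEval (-t) (ePoly (uExt Poly n) n)) = b at *
  refine two_mul_cancel w ?_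
  calc 2 * ((2 * a - 1) * b) = (2 * a - 1) * (2 * b - 1) + (2 * a - 1) := by noncomm_ring
    _ = 2 * a := by rw [h]; noncomm_ring

/-- The coefficients of `E(t)` commute, by comparison of coefficients in `E(s) E(t) = E(t) E(s)`. -/
theorem commute_toQuotient_coeff (k l : ℕ) :
    Commute (toQuotient Poly n w ((ePoly (uExt Poly n) n).coeff k))
      (toQuotient Poly n w ((ePoly (uExt Poly n) n).coeff l)) := by
  set E := ePoly (uExt Poly n) n with hE
  set m := max (E.natDegree + 1) (max (k + 1) (l + 1)) with hm
  have hdeg : E.natDegree < m := by omega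
  have hsum (t : Poly) : toQuotient Poly n w (scalarEval t E) =
      ∑ k ∈ Finset.range m, t ^ k • toQuotient Poly n w (E.coeff k) := by
    rw [scalarEval_eq_sum t hdeg, map_sum]
    exact Finset.sum_congr rfl fun k _ => map_smul _ _ _
  have h1 (s t : Poly) : ∑ k ∈ Finset.range m, s ^ k •
      (toQuotient Poly n w (E.coeff k) * toQuotient Poly n w (scalarEval t E) -
        toQuotient Poly n w (scalarEval t E) * toQuotient Poly n w (E.coeff k)) = 0 := by
    have h := (commute_toQuotient_scalarEval (n := n) (w := w) s t).eq
    rw [← hE, hsum s, Finset.sum_mul, Finset.mul_sum, ← sub_eq_zero, ← Finset.sum_sub_distrib] at h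
    rw [← h]
    refine Finset.sum_congr rfl fun k _ => ?_
    rw [smul_sub, smul_mul_assoc, mul_smul_comm]
  have h2 (t : Poly) : ∑ l ∈ Finset.range m, t ^ l •
      (toQuotient Poly n w (E.coeff k) * toQuotient Poly n w (E.coeff l) -
        toQuotient Poly n w (E.coeff l) * toQuotient Poly n w (E.coeff k)) = 0 := by
    have h := eq_zero_of_forall_sum_eq_zero _ (fun s => h1 s t) k (by omega)
    rw [hsum t, Finset.sum_mul, Finset.mul_sum, ← Finset.sum_sub_distrib] at h
    rw [← h]
    refine Finset.sum_congr rfl fun k _ => ?_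
    rw [smul_sub, smul_mul_assoc, mul_smul_comm]
  exact sub_eq_zero.1 (eq_zero_of_forall_sum_eq_zero _ h2 l (by omega))

theorem isNilpotent_toQuotient_coeff {k : ℕ} (hk : 0 < k) :
    IsNilpotent (toQuotient Poly n w ((ePoly (uExt Poly n) n).coeff k)) := by
  refine isNilpotent_toQuotient ?_
  rw [← Polynomial.coeff_map, map_ePoly]
  have : (fun j => augmentation Poly n (uExt Poly n j)) = fun _ => 0 := by
    ext1 j
    exact nilLift_uExt _ isNilCoxeter_zero j fun _ => rfl
  rw [this, ePoly_zero, Polynomial.coeff_one, if_neg hk.ne']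

open scoped IsMulCommutative in
/-- The product of the `C(x_i)` in terms of the coefficients `e_k` of `(C(t) + 1) / 2`. -/
theorem exists_toQuotient_xPart (n : ℕ) (w : SignedPerm) :
    ∃ (M : ℕ) (G : MvPolynomial (Fin M) (MvPolynomial ℕ ℤ)), ∀ N,
      toQuotient Poly n w (xPart (uExt Poly n) n N xPoly) =
        ∑ d ∈ G.support, qEval N (MvPolynomial.coeff d G) • toQuotient Poly n w
          ((List.ofFn fun j : Fin M => (ePoly (uExt Poly n) n).coeff (j + 1) ^ d j).prod) := by
  set E := ePoly (uExt Poly n) n with hE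
  set M := E.natDegree with hM
  have hsum (t : Poly) : toQuotient Poly n w (scalarEval t E) =
      ∑ k ∈ Finset.range (M + 1), t ^ k • toQuotient Poly n w (E.coeff k) := by
    rw [scalarEval_eq_sum t (Nat.lt_succ_self _), map_sum]
    exact Finset.sum_congr rfl fun k _ => map_smul _ _ _
  let B := Algebra.adjoin Poly (Set.range fun k => toQuotient Poly n w (E.coeff k))
  have : IsMulCommutative B := Algebra.isMulCommutative_adjoin _ (by
    rintro _ ⟨k, rfl⟩ _ ⟨l, rfl⟩
    exact commute_toQuotient_coeff k l)
  let e (k : ℕ) : B := ⟨toQuotient Poly n w (E.coeff k), Algebra.subset_adjoin ⟨k, rfl⟩⟩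
  have hmem (t : Poly) : toQuotient Poly n w (cFactor (uExt Poly n) n t) ∈ B := by
    rw [toQuotient_cFactor, hsum]
    exact sub_mem (mul_mem (ofNat_mem _ 2) (sum_mem fun k _ => B.smul_mem (e k).2 _)) (one_mem _)
  let c (i : ℕ) : B := ⟨toQuotient Poly n w (cFactor (uExt Poly n) n (xPoly i)), hmem _⟩
  obtain ⟨G, hG⟩ := exists_prod_eq_eval (B := B) M e
    (Subtype.ext (by simp [e, hE, coeff_zero_ePoly]))
    (fun k hk => by
      obtain ⟨m, hm⟩ := isNilpotent_toQuotient_coeff (n := n) (w := w) hk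
      exact ⟨m, Subtype.ext hm⟩) c
    (fun i => Subtype.ext (by
      have h := toQuotient_cFactor_mul (n := n) (w := w) (xPoly i)
      rw [← hE, hsum, hsum] at h
      simpa [c, e] using h))
  refine ⟨M, G, fun N => ?_⟩
  have h1 : toQuotient Poly n w (xPart (uExt Poly n) n N xPoly) =
      B.val (∏ i ∈ Finset.range N, c i) := by
    induction N with
    | zero => simp [xPart]
    | succ N ih =>
      rw [Finset.prod_range_succ, map_mul, ← ih, xPart, List.range_succ, List.map_append,
        List.prod_append, map_mul, List.map_singleton, List.prod_singleton]
      rfl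
  rw [h1, hG, MvPolynomial.coe_eval₂Hom, MvPolynomial.eval₂_eq', map_sum]
  refine Finset.sum_congr rfl fun d _ => ?_
  rw [map_mul, RingHom.comp_apply, AlgHom.commutes, ← Algebra.smul_def, map_list_prod,
    List.map_ofFn, ← List.prod_ofFn, map_list_prod, List.map_ofFn]
  congr 3

/-- The elements of the nilCoxeter algebra with coefficients in `ℤ[Y,Z]`. -/
def yzSubring (n : ℕ) : Subring (NilCoxeter Poly n) :=
  (nilMap n n (algebraMap polyYZ Poly)).range

theorem coeff_mem_polyYZ (hw : w ∈ finiteW n) {x : NilCoxeter Poly n} (hx : x ∈ yzSubring n) :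
    coeff w x ∈ polyYZ := by
  obtain ⟨x, rfl⟩ := hx
  rw [coeff_nilMap _ hw]
  exact (coeff w x).2

theorem nilMap_uExt {R R' : Type} [CommRing R] [CommRing R'] (φ : R →+* R') {m : ℕ} (h : n ≤ m)
    (i : ℕ) : nilMap m n φ (uExt R m i) = uExt R' n i :=
  nilLift_uExt φ _ i fun hi => uExt_of_le (h.trans hi)

theorem nilMap_smul {R R' : Type} [CommRing R] [CommRing R'] (φ : R →+* R') {m : ℕ} (r : R)
    (x : NilCoxeter R m) : nilMap m n φ (r • x) = φ r • nilMap m n φ x :=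
  nilLift_smul φ _ r x

theorem coeff_ePoly_mem (n k : ℕ) : (ePoly (uExt Poly n) n).coeff k ∈ yzSubring n := by
  refine ⟨(ePoly (uExt polyYZ n) n).coeff k, ?_⟩
  rw [← Polynomial.coeff_map, map_ePoly]
  simp only [nilMap_uExt _ le_rfl]

theorem yPart_mem (n K : ℕ) : yPart (uExt Poly n) n K yPoly ∈ yzSubring n := by
  refine ⟨yPart (uExt polyYZ n) n K fun j =>
    (⟨yPoly j, Algebra.subset_adjoin (.inl ⟨j, rfl⟩)⟩ : polyYZ), ?_⟩
  rw [map_yPart (nilMap_smul _)]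
  simp only [nilMap_uExt _ le_rfl]
  rfl

theorem zPart_mem (n K : ℕ) : zPart (uExt Poly n) n K zPoly ∈ yzSubring n := by
  refine ⟨zPart (uExt polyYZ n) n K fun j =>
    (⟨zPoly j, Algebra.subset_adjoin (.inr ⟨j, rfl⟩)⟩ : polyYZ), ?_⟩
  rw [map_zPart (nilMap_smul _)]
  simp only [nilMap_uExt _ le_rfl]
  rfl

/-- The coefficients of the finite products converge to an element of `Γ[Y,Z]`. -/
theorem coeff_schubertProduct_mem (hw : w ∈ finiteW n) :
    (fun N => coeff w (schubertProduct n N)) ∈ limitSubalgebra := by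
  obtain ⟨M, G, hG⟩ := exists_toQuotient_xPart n w
  set L := zPart (uExt Poly n) n (n - 1) zPoly with hL
  set R := yPart (uExt Poly n) n (n - 1) yPoly with hR
  set m : (Fin M →₀ ℕ) → NilCoxeter Poly n := fun d =>
    (List.ofFn fun j : Fin M => (ePoly (uExt Poly n) n).coeff (j + 1) ^ d j).prod with hm
  have h1 : (fun N => coeff w (schubertProduct n N)) =
      ∑ d ∈ G.support, (fun N => qEval N (MvPolynomial.coeff d G)) *
        fun _ => coeff w (L * m d * R) := by
    ext1 N
    have h2 := hG N
    have h3 : toQuotient Poly n w (∑ d ∈ G.support, qEval N (MvPolynomial.coeff d G) • m d) =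
        ∑ d ∈ G.support, qEval N (MvPolynomial.coeff d G) • toQuotient Poly n w (m d) := by
      rw [map_sum]
      exact Finset.sum_congr rfl fun d _ => map_smul _ _ _
    rw [← h3, toQuotient_eq_iff] at h2
    rw [schubertProduct_eq, fullProduct, h2, Finset.mul_sum, Finset.sum_mul, map_sum,
      Finset.sum_apply]
    refine Finset.sum_congr rfl fun d _ => ?_
    have h4 (r : Poly) (x y z : NilCoxeter Poly n) : x * r • y * z = r • (x * y * z) :=
      (congrArg (· * z) (Algebra.mul_smul_comm r x y)).trans (Algebra.smul_mul_assoc r (x * y) z)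
    rw [h4, map_smul]
    rfl
  rw [h1]
  refine sum_mem fun d _ => mul_mem (qEval_mem_limitSubalgebra _)
    (const_mem_limitSubalgebra (coeff_mem_polyYZ hw ?_))
  refine mul_mem (mul_mem (zPart_mem n _) (list_prod_mem fun x hx => ?_)) (yPart_mem n _)
  obtain ⟨j, rfl⟩ := (List.mem_ofFn' _ _).1 hx
  exact pow_mem (coeff_ePoly_mem n _) _

end membership

/-! ### The double Schubert polynomials -/

section schubert

variable {n : ℕ} {w : SignedPerm}

theorem schubertAt_spec (hw : w ∈ finiteW n) : schubertAt n w ∈ GammaYZ ∧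
    IsXLimit (fun N => coeff w (schubertProduct n N)) (schubertAt n w) := by
  obtain ⟨f, hf, h⟩ := coeff_schubertProduct_mem hw
  rw [show schubertAt n w = f from h.eq_xLimit]
  exact ⟨hf, h⟩

theorem nilMap_schubertProduct {R : Type} [CommRing R] (φ : Poly →+* R) {m : ℕ} (h : n ≤ m)
    (N : ℕ) : nilMap m n φ (schubertProduct m N) = fullProduct (uExt R n) n N
      (fun j => φ (xPoly j)) (fun j => φ (yPoly j)) fun j => φ (zPoly j) := by
  rw [schubertProduct_eq, map_fullProduct (nilMap_smul φ)]
  simp only [nilMap_uExt φ h]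
  exact fullProduct_cutoff (fun j hj => uExt_of_le hj) h N _ _ _

theorem schubertAt_of_le (hw : w ∈ finiteW n) {m : ℕ} (h : n ≤ m) :
    schubertAt m w = schubertAt n w := by
  unfold schubertAt
  congr 1
  ext1 N
  have h1 := coeff_nilMap (RingHom.id Poly) hw (schubertProduct m N)
  rw [nilMap_schubertProduct _ h] at h1
  rw [schubertProduct_eq n]
  exact h1.symm

/-- The double Schubert polynomials do not depend on the choice of `n`. -/
theorem schubertAt_eq_schubert (hw : w ∈ finiteW n) : schubertAt n w = schubert w :=
  schubertAt_of_le (mem_finiteW_rank w) (Nat.sInf_le hw)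

theorem schubert_mem (w : SignedPerm) : schubert w ∈ GammaYZ :=
  (schubertAt_spec (mem_finiteW_rank w)).1

theorem isXLimit_schubert (hw : w ∈ finiteW n) :
    IsXLimit (fun N => coeff w (schubertProduct n N)) (schubert w) := by
  rw [← schubertAt_eq_schubert hw]
  exact (schubertAt_spec hw).2

theorem aeval_coeff_schubertProduct (hw : w ∈ finiteW n) (a : Var → Poly) (N : ℕ) :
    MvPolynomial.aeval a (coeff w (schubertProduct n N)) =
      coeff w (fullProduct (uExt Poly n) n N (fun j => a (.x j)) (fun j => a (.y j))
        fun j => a (.z j)) := by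
  have h := coeff_nilMap ((MvPolynomial.aeval a : Poly →ₐ[ℤ] Poly) : Poly →+* Poly) hw
    (schubertProduct n N)
  rw [nilMap_schubertProduct _ le_rfl] at h
  refine h.symm.trans ?_
  simp [xPoly, yPoly, zPoly]

/-- The denominators of the divided differences, as polynomials. -/
def denomPoly : ℕ → Poly
  | 0 => -2 * yPoly 0
  | k + 1 => yPoly k - yPoly (k + 1)

theorem coe_denomPoly (i : ℕ) : (denomPoly i : Series) = denom i := by
  cases i with
  | zero =>
    simp only [denomPoly, yPoly, MvPolynomial.coe_mul, MvPolynomial.coe_X]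
    congr 1
    have h := map_ofNat (MvPolynomial.coeToMvPowerSeries.ringHom (σ := Var) (R := ℤ)) 2
    rw [← MvPolynomial.coeToMvPowerSeries.ringHom_apply, map_neg, h]
    rfl
  | succ k =>
    simp only [denomPoly, yPoly]
    rw [← MvPolynomial.coeToMvPowerSeries.ringHom_apply, map_sub]
    simp only [MvPolynomial.coeToMvPowerSeries.ringHom_apply, MvPolynomial.coe_X]
    rfl

theorem coeff_smul_mul_uExt {i : ℕ} (hi : i < n) (w : SignedPerm) (r : Poly)
    (x : NilCoxeter Poly n) : coeff w (r • (x * uExt Poly n i)) =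
      r * if length (w * s i) < length w then coeff (w * s i) x else 0 := by
  rw [map_smul, smul_eq_mul, ← coeff_mul_u w x ⟨i, hi⟩, ← uExt_val]

/-- The divided difference equations in the variables `y`, before division. -/
theorem denom_mul_schubert (i : ℕ) (w : SignedPerm) :
    (denom i : Series) * (if length (w * s i) < length w then schubert (w * s i) else 0) =
      schubert w - reflSeries i (schubert w) := by
  obtain ⟨m, hm⟩ := exists_mem_finiteW w
  -- For this `n`, the factors `A_i(y_i)` and `A_{i+1}(y_{i+1})` both occur in the product.
  set n := m + i + 3 with hn
  have hw : w ∈ finiteW n := finiteW_mono (by omega) hm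
  have hws : w * s i ∈ finiteW n := mul_mem_finiteW hw (finiteW_mono (by omega) (s_mem_finiteW i))
  have hv := isNilCoxeter_uExt Poly n
  have h0 (j : ℕ) (hj : n ≤ j) : uExt Poly n j = 0 := uExt_of_le hj
  have hC := isXLimit_schubert hw
  have hG : IsXLimit (fun N => if length (w * s i) < length w then
      coeff (w * s i) (schubertProduct n N) else 0)
      (if length (w * s i) < length w then schubert (w * s i) else 0) := by
    split_ifs
    · exact isXLimit_schubert hws
    · simpa using IsXLimit.const 0
  have hR : IsXLimit _ (reflSeries i (schubert w)) := hC.subst (isTame_reflVar i)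
  have hD := IsXLimit.const (denomPoly i)
  rw [coe_denomPoly] at hD
  -- For `i = 0`, the substitution turns `x_1, …, x_{N+1}` into `y_1, x_1, …, x_N`, so that the product
  -- with `N + 1` factors `C` is compared with the one with `N` factors.
  cases i with
  | zero =>
    refine IsXLimit.unique (hD.mul hG) ?_
    convert hC.sub hR using 1
    ext1 N
    simp only [Pi.mul_apply, Pi.sub_apply]
    have h1 := hv.fullProduct_zero_sub h0 (by omega) N xPoly yPoly zPoly
      (fun j => reflVar 0 (.x j)) (fun j => reflVar 0 (.y j)) rfl (fun _ => rfl) rfl fun _ => rfl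
    rw [aeval_coeff_schubertProduct hw, schubertProduct_eq, ← map_sub]
    refine Eq.trans ?_ (congrArg (coeff w) h1.symm)
    exact (coeff_smul_mul_uExt (by omega) w _ _).symm
  | succ k =>
    refine IsXLimit.unique (hD.mul hG.shift) ?_
    convert hC.shift.sub hR using 1
    ext1 N
    simp only [Pi.mul_apply, Pi.sub_apply]
    have h1 := hv.fullProduct_swap_sub h0 (k := k) (by omega) (N + 1) xPoly yPoly zPoly
    rw [aeval_coeff_schubertProduct hw, schubertProduct_eq, ← map_sub]
    refine Eq.trans ?_ (congrArg (coeff w) h1.symm)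
    exact (coeff_smul_mul_uExt (by omega) w _ _).symm

/-- The involution `ω` maps `ℭ_w` to `ℭ_{w⁻¹}`. -/
theorem omegaSeries_schubert (w : SignedPerm) : omegaSeries (schubert w) = schubert w⁻¹ := by
  have hw := mem_finiteW_rank w
  set n := rank w
  have hv := isNilCoxeter_uExt Poly n
  refine IsXLimit.unique ((isXLimit_schubert hw).subst isTame_omegaVar) ?_
  convert (isXLimit_schubert (inv_mem_finiteW hw)).shift using 1
  ext1 N
  have h := coeff_nilReverse ((MvPolynomial.aeval omegaVar : Poly →ₐ[ℤ] Poly) : Poly →+* Poly) w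
    (schubertProduct n (N + 1))
  refine h.symm.trans ?_
  rw [schubertProduct_eq, nilReverse, map_fullProduct (nilLift_smul _ _)]
  have hu : (fun j => nilLift n ((MvPolynomial.aeval omegaVar : Poly →ₐ[ℤ] Poly) : Poly →+* Poly)
      (isNilCoxeter_op Poly n) (uExt Poly n j)) = fun j => MulOpposite.op (uExt Poly n j) :=
    funext fun j => nilLift_uExt _ _ j fun hi => by rw [uExt_of_le hi]; rfl
  rw [hu, hv.fullProduct_op fun j hj => uExt_of_le hj]
  simp [xPoly, yPoly, zPoly, omegaVar]
  rfl

theorem constantCoeff_schubert (w : SignedPerm) [Decidable (w = 1)] :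
    MvPowerSeries.constantCoeff (schubert w) = if w = 1 then 1 else 0 := by
  have hw := mem_finiteW_rank w
  have h := isXLimit_schubert hw 0 0 (by simp [xBound])
  rw [MvPowerSeries.coeff_zero_eq_constantCoeff_apply] at h
  rw [h]
  have h1 := coeff_nilMap (MvPolynomial.constantCoeff (σ := Var) (R := ℤ)) hw
    (schubertProduct (rank w) 0)
  rw [nilMap_schubertProduct _ le_rfl] at h1
  refine h1.symm.trans ?_
  have h2 : fullProduct (uExt ℤ (rank w)) (rank w) 0
      (fun j => MvPolynomial.constantCoeff (xPoly j)) (fun j => MvPolynomial.constantCoeff (yPoly j))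
      (fun j => MvPolynomial.constantCoeff (zPoly j)) = 1 := by
    have hl : lin (uExt ℤ (rank w)) (0 : ℤ) = fun _ => 1 := by
      ext1 j
      refine (congrArg (1 + ·) (zero_smul ℤ (uExt ℤ (rank w) j))).trans (add_zero 1)
    simp [fullProduct, zPart, yPart, xPart, xPoly, yPoly, zPoly, asc, desc, hl]
  rw [h2, coeff_one]
  congr

/-- The double Schubert polynomial of `w`, as an element of `Γ[Y,Z]`. -/
def schubertGamma (w : SignedPerm) : GammaYZ := ⟨schubert w, schubert_mem w⟩

theorem divDiffY_schubertGamma (i : ℕ) (w : SignedPerm) : divDiffY i (schubertGamma w) =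
    if length (w * s i) < length w then schubertGamma (w * s i) else 0 := by
  rw [divDiffY_eq_iff]
  refine Subtype.ext (Eq.trans ?_ (denom_mul_schubert i w))
  split_ifs <;> rfl

theorem omega_schubertGamma (w : SignedPerm) : omega (schubertGamma w) = schubertGamma w⁻¹ :=
  Subtype.ext (omegaSeries_schubert w)

theorem divDiffZ_schubertGamma (i : ℕ) (w : SignedPerm) : divDiffZ i (schubertGamma w) =
    if length (s i * w) < length w then schubertGamma (s i * w) else 0 := by
  have hs : (s i)⁻¹ = s i := inv_eq_of_mul_eq_one_left (s_mul_self i)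
  have h1 : w⁻¹ * s i = (s i * w)⁻¹ := by rw [mul_inv_rev, hs]
  rw [divDiffZ, omega_schubertGamma, divDiffY_schubertGamma, h1, length_inv, length_inv]
  split_ifs
  · rw [omega_schubertGamma, inv_inv]
  · rw [map_zero]

theorem isSchubertFamily_schubertGamma : IsSchubertFamily schubertGamma where
  divDiffY_of_lt i w h := by rw [divDiffY_schubertGamma, if_pos h]
  divDiffY_of_not_lt i w h := by rw [divDiffY_schubertGamma, if_neg h]
  divDiffZ_of_lt i w h := by rw [divDiffZ_schubertGamma, if_pos h]
  divDiffZ_of_not_lt i w h := by rw [divDiffZ_schubertGamma, if_neg h]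
  constantCoeff_one := by classical exact (constantCoeff_schubert 1).trans (if_pos rfl)
  constantCoeff_of_ne_one w h := by classical exact (constantCoeff_schubert w).trans (if_neg h)

end schubert

/-! ### Invariant elements of `Γ[Y,Z]` are constants -/

/-- The coefficients of `f(a)` for a substitution `a` of variables by variables up to sign, at the
image of an exponent vector which is the only one with this image that occurs in `f`. -/
theorem coeff_mapDomain_subst {a : Var → Poly} (ha : IsTame a) {σ : Var → Var} {ε : Var → ℤ}
    (h : ∀ v, a v = MvPolynomial.C (ε v) * MvPolynomial.X (σ v)) (f : Series) (d : Var →₀ ℕ)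
    (hinj : ∀ d' : Var →₀ ℕ, MvPowerSeries.coeff d' f ≠ 0 →
      d'.mapDomain σ = d.mapDomain σ → d' = d) :
    MvPowerSeries.coeff (d.mapDomain σ) (MvPowerSeries.substAlgHom ha.hasSubst f) =
      MvPowerSeries.coeff d f * d.prod fun v e => ε v ^ e := by
  classical
  have hprod (d : Var →₀ ℕ) : (d.prod fun v e => (a v : Series) ^ e) =
      ((MvPolynomial.monomial (d.mapDomain σ) (d.prod fun v e => ε v ^ e) : Poly) : Series) := by
    rw [MvPolynomial.monomial_eq, Finsupp.prod_mapDomain_index (by simp) (by intros; ring)]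
    simp only [Finsupp.prod, h, map_prod, ← MvPolynomial.coe_pow, mul_pow, map_pow]
    rw [← Finset.prod_mul_distrib]
    simp only [← MvPolynomial.coeToMvPowerSeries.ringHom_apply, map_prod]
  rw [MvPowerSeries.substAlgHom_apply, MvPowerSeries.coeff_subst ha.hasSubst,
    finsum_eq_single _ d]
  · rw [hprod, MvPolynomial.coeff_coe, MvPolynomial.coeff_monomial, if_pos rfl, smul_eq_mul]
  · intro d' hd'
    by_cases h0 : MvPowerSeries.coeff d' f = 0
    · rw [h0, zero_smul]
    · rw [hprod, MvPolynomial.coeff_coe, MvPolynomial.coeff_monomial,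
        if_neg fun he => hd' (hinj d' h0 he), smul_zero]

theorem mapDomain_apply_ne_zero {σ : Var → Var} {d : Var →₀ ℕ} {v : Var} (h : d v ≠ 0) :
    d.mapDomain σ (σ v) ≠ 0 := by
  classical
  rw [Finsupp.mapDomain, Finsupp.sum_apply, Finsupp.sum]
  intro h0
  rw [Finset.sum_eq_zero_iff] at h0
  exact h (by simpa using h0 v (Finsupp.mem_support_iff.2 h))

/-- An element of `Γ[Y,Z]` involves only finitely many of the variables `y_j`. -/
theorem exists_forall_coeff_eq_zero (f : GammaYZ) : ∃ J, ∀ j, J ≤ j → ∀ m : Var →₀ ℕ,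
    m (.y j) ≠ 0 → MvPowerSeries.coeff m (f : Series) = 0 := by
  classical
  obtain ⟨f, hf⟩ := f
  have hconst (c : ℤ) (j : ℕ) (m : Var →₀ ℕ) (hm : m (.y j) ≠ 0) :
      MvPowerSeries.coeff m (algebraMap ℤ Series c) = 0 := by
    rw [MvPowerSeries.algebraMap_apply, MvPowerSeries.coeff_C, if_neg]
    rintro rfl
    exact hm rfl
  have hX (v : Var) (j : ℕ) (hv : v ≠ .y j) (m : Var →₀ ℕ) (hm : m (.y j) ≠ 0) :
      MvPowerSeries.coeff m (MvPowerSeries.X v : Series) = 0 := by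
    rw [MvPowerSeries.coeff_X, if_neg]
    rintro rfl
    exact hm (by rw [Finsupp.single_apply, if_neg hv])
  have hmul {f g : Series} {j : ℕ}
      (hf : ∀ m : Var →₀ ℕ, m (.y j) ≠ 0 → MvPowerSeries.coeff m f = 0)
      (hg : ∀ m : Var →₀ ℕ, m (.y j) ≠ 0 → MvPowerSeries.coeff m g = 0) (m : Var →₀ ℕ)
      (hm : m (.y j) ≠ 0) : MvPowerSeries.coeff m (f * g) = 0 := by
    rw [MvPowerSeries.coeff_mul]
    refine Finset.sum_eq_zero fun d hd => ?_
    rw [Finset.HasAntidiagonal.mem_antidiagonal] at hd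
    rw [← hd, Finsupp.add_apply] at hm
    by_cases h1 : d.1 (.y j) = 0
    · rw [hg _ (by omega), mul_zero]
    · rw [hf _ h1, zero_mul]
  induction hf using Algebra.adjoin_induction with
  | mem f hf =>
    rcases hf with (⟨r, rfl⟩ | ⟨k, rfl⟩) | ⟨k, rfl⟩
    · refine ⟨0, fun j _ m hm => ?_⟩
      rw [coeff_q r (le_refl (xBound m))]
      generalize xBound m = N
      induction N generalizing r m with
      | zero =>
        have h1 : qPoly r 0 = MvPolynomial.C (if r = 0 then 1 else 0) := by
          simp [qPoly, PowerSeries.coeff_one]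
        rw [h1, MvPolynomial.coeff_C, if_neg]
        rintro rfl
        exact hm rfl
      | succ N ih =>
        rw [qPoly_succ, MvPolynomial.coeff_sum]
        refine Finset.sum_eq_zero fun p _ => ?_
        rw [← MvPolynomial.coeff_coe, MvPolynomial.coe_mul]
        refine hmul (fun m hm => ?_) (fun m hm => ?_) m hm
        · rw [MvPolynomial.coeff_coe]
          exact ih p.1 m hm
        · rw [MvPolynomial.coeff_coe, qFactorCoeff]
          split_ifs
          · rw [MvPolynomial.coeff_one, if_neg]
            rintro rfl
            exact hm rfl
          · have h2 : (2 : Poly) = MvPolynomial.C 2 := (map_ofNat MvPolynomial.C 2).symm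
            rw [h2, MvPolynomial.coeff_C_mul, MvPolynomial.coeff_X_pow, if_neg, mul_zero]
            rintro rfl
            exact hm (by rw [Finsupp.single_apply, if_neg (by simp)])
    · exact ⟨k + 1, fun j hj => hX _ j (by simp; omega)⟩
    · exact ⟨0, fun j _ => hX _ j (by simp)⟩
  | algebraMap c => exact ⟨0, fun j _ => hconst c j⟩
  | add f g _ _ hf hg =>
    obtain ⟨J, hJ⟩ := hf
    obtain ⟨K, hK⟩ := hg
    refine ⟨max J K, fun j hj m hm => ?_⟩
    rw [map_add, hJ j (by omega) m hm, hK j (by omega) m hm, add_zero]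
  | mul f g _ _ hf hg =>
    obtain ⟨J, hJ⟩ := hf
    obtain ⟨K, hK⟩ := hg
    exact ⟨max J K, fun j hj => hmul (hJ j (by omega)) (hK j (by omega))⟩

/-- A symmetric element does not involve the variables `y_j`. -/
theorem coeff_eq_zero_of_refl_eq {f : GammaYZ} (hf : ∀ i, refl (i + 1) f = f) (j : ℕ)
    (m : Var →₀ ℕ) (hm : m (.y j) ≠ 0) : MvPowerSeries.coeff m (f : Series) = 0 := by
  obtain ⟨J, hJ⟩ := exists_forall_coeff_eq_zero f
  induction j using downward_induction J generalizing m with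
  | hb j hj => exact hJ j hj m hm
  | hs j ih =>
    -- Move the variable `y_j` to `y_{j+1}`.
    let σ : Var → Var := fun | .y k => .y (Equiv.swap j (j + 1) k) | v => v
    have hσ : Function.Involutive σ := by rintro (k | k | k) <;> simp [σ]
    have h := coeff_mapDomain_subst (isTame_reflVar (j + 1)) (σ := σ) (ε := fun _ => 1)
      (by rintro (k | k | k) <;> simp [reflVar, σ]) f m
      fun d' _ hd' => Finsupp.mapDomain_injective hσ.injective hd'
    have h2 : MvPowerSeries.coeff (m.mapDomain σ) (f : Series) =
        MvPowerSeries.coeff m (f : Series) := by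
      have h3 : reflSeries (j + 1) f = f := congrArg Subtype.val (hf j)
      rw [← reflSeries, h3] at h
      simpa using h
    rw [← h2]
    refine ih (j + 1) (Nat.lt_succ_self j) _ ?_
    have := mapDomain_apply_ne_zero (σ := σ) hm
    simpa [σ] using this

/-- A power series in the variables `X` alone that is fixed by `s_0` is a constant. -/
theorem coeff_eq_zero_of_reflSeries_zero_eq {f : Series} (hf : reflSeries 0 f = f)
    (hx : ∀ m : Var →₀ ℕ, MvPowerSeries.coeff m f ≠ 0 → ∀ v, m v ≠ 0 → ∃ k, v = .x k)
    {m : Var →₀ ℕ} (hm : m ≠ 0) : MvPowerSeries.coeff m f = 0 := by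
  let σ : Var → Var := fun | .x 0 => .y 0 | .x (k + 1) => .x k | v => v
  let ε : Var → ℤ := fun | .y 0 => -1 | _ => 1
  have key (m : Var →₀ ℕ) (hmf : MvPowerSeries.coeff m f ≠ 0) :
      MvPowerSeries.coeff (m.mapDomain σ) f ≠ 0 := by
    have h := coeff_mapDomain_subst (isTame_reflVar 0) (σ := σ) (ε := ε)
      (by rintro ((_ | k) | (_ | k) | k) <;> simp [reflVar, σ, ε]) f m (fun d' hd' he => by
        refine Finsupp.mapDomain_injOn (f := σ) (Set.range Var.x) ?_ ?_ ?_ he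
        · rintro _ ⟨j | j, rfl⟩ _ ⟨k | k, rfl⟩ hjk <;> simp_all [σ]
        · intro v hv
          obtain ⟨k, rfl⟩ := hx d' hd' v (Finsupp.mem_support_iff.1 hv)
          exact ⟨k, rfl⟩
        · intro v hv
          obtain ⟨k, rfl⟩ := hx m hmf v (Finsupp.mem_support_iff.1 hv)
          exact ⟨k, rfl⟩)
    rw [← reflSeries, hf] at h
    rw [h]
    refine mul_ne_zero hmf (Finset.prod_ne_zero_iff.2 fun v _ => pow_ne_zero _ ?_)
    rcases v with k | (_ | k) | k <;> simp [ε]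
  -- Applying `s_0` lowers the index of a variable `x_k`, until `y_1` would occur.
  have step (k : ℕ) : ∀ m : Var →₀ ℕ, m (.x k) ≠ 0 → MvPowerSeries.coeff m f = 0 := by
    induction k with
    | zero =>
      intro m hm
      by_contra hne
      obtain ⟨k, hk⟩ := hx _ (key m hne) (.y 0) (mapDomain_apply_ne_zero (σ := σ) hm)
      cases hk
    | succ k ih =>
      intro m hm
      by_contra hne
      exact key m hne (ih _ (mapDomain_apply_ne_zero (σ := σ) hm))
  by_contra hne
  obtain ⟨v, hv⟩ := Finsupp.ne_iff.1 hm
  obtain ⟨k, rfl⟩ := hx m hne v hv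
  exact hne (step k m hv)

theorem omega_omega (f : GammaYZ) : omega (omega f) = f := by
  have h : GammaYZ ≤ AlgHom.equalizer (omegaSeries.comp omegaSeries) (AlgHom.id ℤ Series) := by
    refine Algebra.adjoin_le ?_
    rintro _ ((⟨r, rfl⟩ | ⟨j, rfl⟩) | ⟨j, rfl⟩)
    · simp [omegaSeries_q]
    · simp [omegaSeries_X, omegaVar, coe_neg_X_var, map_neg]
    · simp [omegaSeries_X, omegaVar, coe_neg_X_var, map_neg]
  exact Subtype.ext (h f.2)

/-- An element of `Γ[Y,Z]` that is fixed by all `s_i` and by all their conjugates under `ω`, and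
whose constant term vanishes, is zero. -/
theorem eq_zero_of_invariant {f : GammaYZ} (hy : ∀ i, refl i f = f)
    (hz : ∀ i, refl i (omega f) = omega f) (h0 : MvPowerSeries.constantCoeff (f : Series) = 0) :
    f = 0 := by
  have h1 := coeff_eq_zero_of_refl_eq fun i => hy (i + 1)
  have h2 (j : ℕ) (m : Var →₀ ℕ) (hm : m (.z j) ≠ 0) :
      MvPowerSeries.coeff m (f : Series) = 0 := by
    let σ : Var → Var := fun | .x i => .x i | .y i => .z i | .z i => .y i
    let ε : Var → ℤ := fun | .x _ => 1 | _ => -1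
    have hσ : Function.Involutive σ := by rintro (k | k | k) <;> simp [σ]
    have h := coeff_mapDomain_subst isTame_omegaVar (σ := σ) (ε := ε)
      (by rintro (k | k | k) <;> simp [omegaVar, σ, ε]) f m
      fun d' _ hd' => Finsupp.mapDomain_injective hσ.injective hd'
    have h3 := coeff_eq_zero_of_refl_eq (fun i => hz (i + 1)) j (m.mapDomain σ)
      (mapDomain_apply_ne_zero (σ := σ) hm)
    rw [← omegaSeries, show omegaSeries f = (omega f : Series) from rfl, h3] at h
    refine (mul_eq_zero.1 h.symm).resolve_right
      (Finset.prod_ne_zero_iff.2 fun v _ => pow_ne_zero _ ?_)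
    rcases v with k | k | k <;> simp [ε]
  have hx : ∀ m : Var →₀ ℕ, MvPowerSeries.coeff m (f : Series) ≠ 0 → ∀ v, m v ≠ 0 →
      ∃ k, v = .x k := by
    rintro m hm (k | k | k) hk
    · exact ⟨k, rfl⟩
    · exact absurd (h1 k m hk) hm
    · exact absurd (h2 k m hk) hm
  refine Subtype.ext ?_
  ext m
  rw [Subalgebra.coe_zero, map_zero]
  by_cases hm : m = 0
  · rw [hm]; exact h0
  · exact coeff_eq_zero_of_reflSeries_zero_eq (congrArg Subtype.val (hy 0)) hx hm

/-- The kernel of `∂_i^y` consists of the elements fixed by `s_i`. -/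
theorem refl_sub_eq {i : ℕ} {f g : GammaYZ} (h : divDiffY i f = divDiffY i g) :
    refl i (f - g) = f - g := by
  have h1 := denom_mul_divDiffY i f
  rw [h, denom_mul_divDiffY] at h1
  rw [map_sub]
  linear_combination h1

/-- The divided difference equations have at most one solution. -/
theorem IsSchubertFamily.unique {F F' : SignedPerm → GammaYZ} (hF : IsSchubertFamily F)
    (hF' : IsSchubertFamily F') (w : SignedPerm) : F w = F' w := by
  induction hl : length w using Nat.strong_induction_on generalizing w with
  | h l ih =>
    subst hl
    refine sub_eq_zero.1 (eq_zero_of_invariant (fun i => refl_sub_eq ?_) (fun i => ?_) ?_)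
    · by_cases h : length (w * s i) < length w
      · rw [hF.divDiffY_of_lt i w h, hF'.divDiffY_of_lt i w h, ih _ h _ rfl]
      · rw [hF.divDiffY_of_not_lt i w h, hF'.divDiffY_of_not_lt i w h]
    · rw [map_sub]
      refine refl_sub_eq (Function.LeftInverse.injective omega_omega ?_)
      change divDiffZ i (F w) = divDiffZ i (F' w)
      by_cases h : length (s i * w) < length w
      · rw [hF.divDiffZ_of_lt i w h, hF'.divDiffZ_of_lt i w h, ih _ h _ rfl]
      · rw [hF.divDiffZ_of_not_lt i w h, hF'.divDiffZ_of_not_lt i w h]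
    · rw [Subalgebra.coe_sub, map_sub]
      by_cases h : w = 1
      · rw [h, hF.constantCoeff_one, hF'.constantCoeff_one, sub_self]
      · rw [hF.constantCoeff_of_ne_one w h, hF'.constantCoeff_of_ne_one w h, sub_self]

end TypeC

end

theorem mainTheorem1 :
    (∀ (n : ℕ) (w : TypeC.SignedPerm), w ∈ TypeC.finiteW n →
      TypeC.schubertAt n w = TypeC.schubert w) ∧
    ∃ hmem : ∀ w : TypeC.SignedPerm, TypeC.schubert w ∈ TypeC.GammaYZ,
      TypeC.IsSchubertFamily (fun w => ⟨TypeC.schubert w, hmem w⟩) ∧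
      ∀ F : TypeC.SignedPerm → TypeC.GammaYZ, TypeC.IsSchubertFamily F →
        ∀ w, (F w : TypeC.Series) = TypeC.schubert w :=
  ⟨fun _ _ hw => TypeC.schubertAt_eq_schubert hw, TypeC.schubert_mem,
    TypeC.isSchubertFamily_schubertGamma, fun _ hF w =>
      congrArg Subtype.val (hF.unique TypeC.isSchubertFamily_schubertGamma w)⟩
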